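/- Work in the complex projective plane $\mathbb P^2=\mathbb P^2(\mathbb C)$. Let $F,G$ be linearly independent homogeneous cubic polynomials in three variables, and let $P(C)=\{F-CG=0\}$, $C\in\mathbb C$, be the pencil of cubic curves they span; its base-points are the points of $\mathbb P^2$ with $F=G=0$. Suppose that the pencil is non-singular, i.e. that $P(C)$ is a non-singular curve for all but finitely many $C$. Let $b_0,\dots,b_6$ be seven distinct simple base-points, i.e. base-points that are simple points of $P(C)$ for all but finitely many $C$ (the curves of the pencil may be tangent to each other at a simple base-point; there may be further base-points). Let $Q$ be a curve of degree $3$ for which $b_0$ is a double point (multiplicity exactly $2$) and $b_1,\dots,b_6$ are simple points (multiplicity exactly $1$). Assume that $F=0$ and $G=0$ have intersection number $1$ at $b_0$, or that $Q$ is not itself a curve of the pencil (its equation is not a linear combination of $F$ and $G$). Then $Q$ is an involution curve for the pencil: for all but finitely many $C$, $$\sum_{p\ \text{base-point}} I_p\bigl(Q,P(C)\bigr)=3\deg(Q)-1=8,$$ where $I_p(Q,R)=\dim_{\mathbb C}\mathcal O_{\mathbb P^2,p}/(Q,R)$ denotes the intersection number at $p$. More precisely, for all but finitely many $C$, $I_{b_0}(Q,P(C))=2$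 and $I_{b_i}(Q,P(C))=1$ for $i=1,\dots,6$, so that the sum is $2+6=8$. -/

import Mathlib

open Filter MvPolynomial
open scoped LinearAlgebra.Projectivization

noncomputable section

namespace CubicPencils

/-- The complex projective plane. -/
abbrev Plane : Type := ℙ ℂ (Fin 3 → ℂ)

/-- Forms (homogeneity is imposed separately) in three variables; a plane curve of degree `d`
is given by a nonzero form of degree `d`. -/
abbrev Form : Type := MvPolynomial (Fin 3) ℂ

/-- Dehomogenization in the chart where the `i`-th coordinate is nonzero: the `i`-th variable is
set to `1` and the two others become the affine coordinates. -/
def dehomogenize (i : Fin 3) : Form →ₐ[ℂ] MvPolynomial (Fin 2) ℂ :=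
  aeval (Fin.insertNth (α := fun _ => MvPolynomial (Fin 2) ℂ) i 1 X)

/-- An index of a chart containing the point `p`. -/
def chart (p : Plane) : Fin 3 :=
  (Function.ne_iff.mp p.rep_nonzero).choose

/-- The affine coordinates of `p` in the chart `chart p`. -/
def affineCoord (p : Plane) : Fin 2 → ℂ :=
  fun j => p.rep ((chart p).succAbove j) / p.rep (chart p)

/-- The local affine equation, in the chart `chart p`, of the curve defined by a form. -/
def localEquation (Q : Form) (p : Plane) : MvPolynomial (Fin 2) ℂ :=
  dehomogenize (chart p) Q

/-- The maximal ideal of the point `a` of the affine plane. -/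
def pointIdeal (a : Fin 2 → ℂ) : Ideal (MvPolynomial (Fin 2) ℂ) :=
  RingHom.ker (eval a)

instance (a : Fin 2 → ℂ) : (pointIdeal a).IsPrime :=
  RingHom.ker_isPrime (eval a)

/-- The local ring of the affine plane at the point `a`. -/
abbrev LocalRingAt (a : Fin 2 → ℂ) : Type :=
  Localization.AtPrime (pointIdeal a)

/-- The intersection number `dim_ℂ 𝒪_a / (f, g)` of the affine curves `f = 0` and `g = 0` at `a`
(the length of a vector space is its dimension; it is `⊤` in infinite dimension). -/
def affineIntersectionNumber (f g : MvPolynomial (Fin 2) ℂ) (a : Fin 2 → ℂ) : ℕ∞ :=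
  Module.length ℂ
    (LocalRingAt a ⧸ Ideal.span {algebraMap (MvPolynomial (Fin 2) ℂ) (LocalRingAt a) f,
      algebraMap (MvPolynomial (Fin 2) ℂ) (LocalRingAt a) g})

/-- The intersection number of the projective plane curves `Q = 0` and `R = 0` at `p`. -/
def intersectionNumber (Q R : Form) (p : Plane) : ℕ∞ :=
  affineIntersectionNumber (localEquation Q p) (localEquation R p) (affineCoord p)

/-- `p` is a point of multiplicity exactly `m` of the curve `Q = 0`: it is a simple point for
`m = 1` and a double point for `m = 2`. -/
def HasMultiplicity (Q : Form) (p : Plane) (m : ℕ) : Prop :=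
  localEquation Q p ∈ pointIdeal (affineCoord p) ^ m ∧
    localEquation Q p ∉ pointIdeal (affineCoord p) ^ (m + 1)

/-- The point `p` lies on the curve `Q = 0`. -/
def LiesOn (p : Plane) (Q : Form) : Prop :=
  eval p.rep Q = 0

/-- A curve is non-singular if all of its points are simple. -/
def IsNonsingularCurve (Q : Form) : Prop :=
  ∀ p : Plane, LiesOn p Q → HasMultiplicity Q p 1

/-- A pencil of plane cubic curves, spanned by two distinct cubics `F = 0` and `G = 0`. -/
structure CubicPencil where
  F : Form
  G : Form
  homogeneous_F : F.IsHomogeneous 3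
  homogeneous_G : G.IsHomogeneous 3
  linearIndependent : LinearIndependent ℂ ![F, G]

namespace CubicPencil

/-- The curve `F - C G = 0` of the pencil. -/
def member (P : CubicPencil) (C : ℂ) : Form :=
  P.F - MvPolynomial.C C * P.G

/-- The base-points of the pencil, that is, the solutions of `F = G = 0`. -/
def basePoints (P : CubicPencil) : Set Plane :=
  {p | LiesOn p P.F ∧ LiesOn p P.G}

/-- The pencil is non-singular if its general curve is non-singular. -/
def IsNonsingular (P : CubicPencil) : Prop :=
  ∀ᶠ C in cofinite, IsNonsingularCurve (P.member C)

/-- A simple base-point: a base-point that is a simple point of the general curve of the pencil.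
The curves of the pencil may be tangent to each other there. -/
def IsSimpleBasePoint (P : CubicPencil) (p : Plane) : Prop :=
  p ∈ P.basePoints ∧ ∀ᶠ C in cofinite, HasMultiplicity (P.member C) p 1

/-- The curve `Q = 0` of degree `d` is an involution curve for the pencil: the intersection
numbers of `Q` and the general curve of the pencil at the base-points have sum `3 d - 1`. -/
def IsInvolutionCurve (P : CubicPencil) (d : ℕ) (Q : Form) : Prop :=
  Q.IsHomogeneous d ∧ Q ≠ 0 ∧
    ∀ᶠ C in cofinite,
      (∑ᶠ p ∈ P.basePoints, intersectionNumber Q (P.member C) p) + 1 = 3 * (d : ℕ∞)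

end CubicPencil

end CubicPencils

end

/-! The heart is a Cayley-Bacharach statement. If `Q` is not in the pencil, it can satisfy no eighth
linear condition shared by the pencil: it passes through no further base-point
(`not_liesOn_of_notMem_span`), and at no `b i` does it share a tangent direction with both `F` and
`G` (`false_of_common_tangent`). The second alternative of `hPQ` says outright that `Q` is not in
the pencil. The first implies it: a member singular at `b 0` would make the gradients of `F` and `G`
dependent there, so `F` and `G` would have a common tangent direction and intersection number at
least 2.

Cayley-Bacharach is proved with quartics. Let `E` be a nonsingular member of the pencil. A line
meets `E` in at most three points, so products of four lines separate the eight conditions. The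
conditions are therefore independent on the 15-dimensional space of quartics and leave a space of
dimension at most 7. It contains all products of linear forms with `E`, `G`, `Q`, a 9-parameter
family, so there are two independent linear syzygies. As `E` is irreducible and does not divide `G`,
eliminating `Q` between them puts `Q` in the span of `E` and `G` (`mem_span_of_two_relations`).

The rest is local. At `b i` with `i ≠ 0`, tangency of `Q` to `F - C G` is an affine condition on
`C`; at `b 0`, where `F` and `G` must be transversal, contact of `F - C G` with the tangent cone of
`Q` is a quadratic condition on `C`. Neither condition holds identically, so the general member has
intersection numbers 1 and 2 with `Q`, and the other base-points contribute 0. -/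

noncomputable section

namespace CubicPencils

/-- The derivative of polynomials in the constant direction `w`. -/
def dirDeriv {σ : Type*} (w : σ → ℂ) :
    Derivation ℂ (MvPolynomial σ ℂ) (MvPolynomial σ ℂ) :=
  mkDerivation ℂ fun i => C (w i)

section DirDeriv

variable {σ : Type*}

@[simp]
theorem dirDeriv_X (w : σ → ℂ) (i : σ) : dirDeriv w (X i) = C (w i) :=
  mkDerivation_X _ _ _

@[simp]
theorem dirDeriv_C (w : σ → ℂ) (c : ℂ) : dirDeriv w (C c) = 0 :=
  (dirDeriv w).map_algebraMap c

theorem dirDeriv_mul (w : σ → ℂ) (f g : MvPolynomial σ ℂ) :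
    dirDeriv w (f * g) = f * dirDeriv w g + g * dirDeriv w f := by
  simp [Derivation.leibniz]

end DirDeriv

/-! ### Local intersection numbers in the affine plane. -/

section Local

variable {a : Fin 2 → ℂ} {f g h : MvPolynomial (Fin 2) ℂ}

theorem mem_pointIdeal : f ∈ pointIdeal a ↔ eval a f = 0 :=
  RingHom.mem_ker

theorem X_sub_C_mem_pointIdeal (a : Fin 2 → ℂ) (i : Fin 2) : X i - C (a i) ∈ pointIdeal a := by
  simp [mem_pointIdeal]

theorem exists_sub_eval_eq (a : Fin 2 → ℂ) (f : MvPolynomial (Fin 2) ℂ) :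
    ∃ g₀ g₁, f = C (eval a f) + ((X 0 - C (a 0)) * g₀ + (X 1 - C (a 1)) * g₁) := by
  induction f using MvPolynomial.induction_on with
  | C c => exact ⟨0, 0, by simp⟩
  | add f g hf hg =>
    obtain ⟨f₀, f₁, hf⟩ := hf
    obtain ⟨g₀, g₁, hg⟩ := hg
    refine ⟨f₀ + g₀, f₁ + g₁, ?_⟩
    rw [map_add, C_add]
    linear_combination hf + hg
  | mul_X f i hf =>
    obtain ⟨f₀, f₁, hf⟩ := hf
    rw [map_mul, C_mul, eval_X]
    fin_cases i
    · refine ⟨f₀ * X 0 + C (eval a f), f₁ * X 0, ?_⟩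
      simp only [Fin.zero_eta]
      linear_combination X 0 * hf
    · refine ⟨f₀ * X 1, f₁ * X 1 + C (eval a f), ?_⟩
      simp only [Fin.mk_one]
      linear_combination X 1 * hf

theorem exists_eq_of_mem_pointIdeal (hf : f ∈ pointIdeal a) :
    ∃ g₀ g₁, f = (X 0 - C (a 0)) * g₀ + (X 1 - C (a 1)) * g₁ := by
  obtain ⟨g₀, g₁, hg⟩ := exists_sub_eval_eq a f
  exact ⟨g₀, g₁, by rwa [mem_pointIdeal.mp hf, C_0, zero_add] at hg⟩

theorem eval_dirDeriv_of_mem_sq (hf : f ∈ pointIdeal a ^ 2) (w : Fin 2 → ℂ) :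
    eval a (dirDeriv w f) = 0 := by
  rw [pow_two] at hf
  refine Submodule.mul_induction_on hf (fun x hx y hy => ?_) fun x y hx hy => ?_
  · rw [mem_pointIdeal] at hx hy
    simp [hx, hy]
  · simp [hx, hy]

/-- The first-order Taylor expansion at a zero. -/
theorem linear_expansion (hf : f ∈ pointIdeal a) :
    f - (C (eval a (dirDeriv (Pi.single 0 1) f)) * (X 0 - C (a 0)) +
      C (eval a (dirDeriv (Pi.single 1 1) f)) * (X 1 - C (a 1))) ∈ pointIdeal a ^ 2 := by
  obtain ⟨g₀, g₁, rfl⟩ := exists_eq_of_mem_pointIdeal hf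
  have h₀ : g₀ - C (eval a g₀) ∈ pointIdeal a := by simp [mem_pointIdeal]
  have h₁ : g₁ - C (eval a g₁) ∈ pointIdeal a := by simp [mem_pointIdeal]
  have := add_mem (Ideal.mul_mem_mul (X_sub_C_mem_pointIdeal a 0) h₀)
    (Ideal.mul_mem_mul (X_sub_C_mem_pointIdeal a 1) h₁)
  rw [← pow_two] at this
  convert this using 1
  simp
  ring

theorem eval_dirDeriv_eq (hf : f ∈ pointIdeal a) (w : Fin 2 → ℂ) :
    eval a (dirDeriv w f) = w 0 * eval a (dirDeriv (Pi.single 0 1) f) +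
      w 1 * eval a (dirDeriv (Pi.single 1 1) f) := by
  obtain ⟨g₀, g₁, rfl⟩ := exists_eq_of_mem_pointIdeal hf
  simp
  ring

theorem mem_sq_of_dirDeriv (hf : f ∈ pointIdeal a)
    (h : ∀ w, eval a (dirDeriv w f) = 0) : f ∈ pointIdeal a ^ 2 := by
  simpa [h] using linear_expansion hf

/-- The second-order Taylor expansion at a singular point. -/
theorem exists_quadratic_expansion (hf : f ∈ pointIdeal a ^ 2) : ∃ α β γ : ℂ,
    f - (C α * (X 0 - C (a 0)) ^ 2 + C β * ((X 0 - C (a 0)) * (X 1 - C (a 1))) +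
      C γ * (X 1 - C (a 1)) ^ 2) ∈ pointIdeal a ^ 3 := by
  have key : ∀ g ∈ pointIdeal a, ∃ c d : ℂ, g - (C c * (X 0 - C (a 0)) +
      C d * (X 1 - C (a 1))) ∈ pointIdeal a ^ 2 := fun g hg => ⟨_, _, linear_expansion hg⟩
  obtain ⟨g₀, g₁, hg⟩ := exists_eq_of_mem_pointIdeal (Ideal.pow_le_self two_ne_zero hf)
  have hd := eval_dirDeriv_of_mem_sq hf
  have h₀ : g₀ ∈ pointIdeal a := by
    simpa [hg, mem_pointIdeal] using hd (Pi.single 0 1)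
  have h₁ : g₁ ∈ pointIdeal a := by
    simpa [hg, mem_pointIdeal] using hd (Pi.single 1 1)
  obtain ⟨c₀, d₀, h₀⟩ := key g₀ h₀
  obtain ⟨c₁, d₁, h₁⟩ := key g₁ h₁
  refine ⟨c₀, d₀ + c₁, d₁, ?_⟩
  have := add_mem (Ideal.mul_mem_mul (X_sub_C_mem_pointIdeal a 0) h₀)
    (Ideal.mul_mem_mul (X_sub_C_mem_pointIdeal a 1) h₁)
  rw [← pow_succ'] at this
  convert this using 1
  rw [hg, C_add]
  ring

/-- Evaluation at the first-order infinitely near point of `a` in the direction `v`. -/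
def evalDual (a v : Fin 2 → ℂ) : MvPolynomial (Fin 2) ℂ →ₐ[ℂ] DualNumber ℂ :=
  aeval fun j => TrivSqZeroExt.inl (a j) + TrivSqZeroExt.inr (v j)

theorem evalDual_apply (a v : Fin 2 → ℂ) (f : MvPolynomial (Fin 2) ℂ) :
    evalDual a v f =
      TrivSqZeroExt.inl (eval a f) + TrivSqZeroExt.inr (eval a (dirDeriv v f)) := by
  induction f using MvPolynomial.induction_on with
  | C c =>
    rw [← algebraMap_eq, AlgHom.commutes, algebraMap_eq]
    ext <;> simp [TrivSqZeroExt.algebraMap_eq_inl]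
  | add f g hf hg => rw [map_add, hf, hg]; ext <;> simp
  | mul_X f i hf =>
    rw [map_mul, hf]
    ext <;> simp [evalDual, mul_comm, add_comm]

theorem evalDual_eq_zero_iff {a v : Fin 2 → ℂ} :
    evalDual a v f = 0 ↔ f ∈ pointIdeal a ∧ eval a (dirDeriv v f) = 0 := by
  rw [evalDual_apply, TrivSqZeroExt.ext_iff]
  simp [mem_pointIdeal]

theorem isUnit_evalDual {a v : Fin 2 → ℂ} (hf : f ∉ pointIdeal a) : IsUnit (evalDual a v f) := by
  rw [TrivSqZeroExt.isUnit_iff_isUnit_fst, evalDual_apply]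
  simpa [mem_pointIdeal] using hf

theorem evalDual_surjective (a : Fin 2 → ℂ) {v : Fin 2 → ℂ} (hv : v ≠ 0) :
    Function.Surjective (evalDual a v) := by
  intro x
  obtain ⟨i, hi⟩ := Function.ne_iff.mp hv
  refine ⟨C x.fst + C (x.snd / v i) * (X i - C (a i)), ?_⟩
  rw [evalDual_apply]
  ext
  · simp
  · simp
    field_simp [show v i ≠ 0 from hi]

theorem length_dualNumber : Module.length ℂ (DualNumber ℂ) = 2 := by
  have : Module.length ℂ (ℂ × ℂ) = 2 := by
    rw [Module.length_prod, Module.length_eq_one]; rfl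
  exact this

section Lift

variable {A : Type*} [CommRing A] [Algebra ℂ A] (φ : MvPolynomial (Fin 2) ℂ →ₐ[ℂ] A)

/-- The extension to the local ring at `a` of a homomorphism that is invertible outside of the
ideal of `a`. -/
def liftLocal (hu : ∀ s ∉ pointIdeal a, IsUnit (φ s)) : LocalRingAt a →ₐ[ℂ] A :=
  IsLocalization.liftAlgHom (M := (pointIdeal a).primeCompl) (f := φ) fun s => hu s s.2

theorem liftLocal_algebraMap (hu : ∀ s ∉ pointIdeal a, IsUnit (φ s))
    (f : MvPolynomial (Fin 2) ℂ) :
    liftLocal φ hu (algebraMap _ (LocalRingAt a) f) = φ f := by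
  simp [liftLocal]

theorem liftLocal_surjective (hu : ∀ s ∉ pointIdeal a, IsUnit (φ s))
    (hs : Function.Surjective φ) : Function.Surjective (liftLocal φ hu) := fun x => by
  obtain ⟨f, rfl⟩ := hs x
  exact ⟨_, liftLocal_algebraMap φ hu f⟩

theorem span_le_ker_liftLocal (hu : ∀ s ∉ pointIdeal a, IsUnit (φ s)) (hf : φ f = 0)
    (hg : φ g = 0) :
    Ideal.span {algebraMap _ (LocalRingAt a) f, algebraMap _ (LocalRingAt a) g} ≤
      RingHom.ker (liftLocal φ hu) := by
  rw [Ideal.span_le, Set.insert_subset_iff, Set.singleton_subset_iff]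
  simp [RingHom.mem_ker, liftLocal_algebraMap, hf, hg]

theorem length_le_affineIntersectionNumber (hu : ∀ s ∉ pointIdeal a, IsUnit (φ s))
    (hs : Function.Surjective φ) (hf : φ f = 0) (hg : φ g = 0) :
    Module.length ℂ A ≤ affineIntersectionNumber f g a :=
  Module.length_le_of_surjective
    (Ideal.Quotient.liftₐ _ (liftLocal φ hu)
      (span_le_ker_liftLocal φ hu hf hg)).toLinearMap <| by
    intro x
    obtain ⟨y, rfl⟩ := liftLocal_surjective φ hu hs x
    exact ⟨Ideal.Quotient.mk _ y, rfl⟩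

/-- Intersection numbers are computed by exhibiting the quotient of the local ring: ℂ for a
transversal intersection, the dual numbers for intersection number two. A fraction is a polynomial
times a unit, so the kernel need only be checked on polynomials. -/
theorem affineIntersectionNumber_eq_length (hu : ∀ s ∉ pointIdeal a, IsUnit (φ s))
    (hs : Function.Surjective φ) (hf : φ f = 0) (hg : φ g = 0)
    (hker : ∀ h, φ h = 0 → algebraMap _ (LocalRingAt a) h ∈
      Ideal.span {algebraMap _ (LocalRingAt a) f, algebraMap _ (LocalRingAt a) g}) :
    affineIntersectionNumber f g a = Module.length ℂ A := by
  have hJ : Ideal.span {algebraMap _ (LocalRingAt a) f, algebraMap _ (LocalRingAt a) g} =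
      RingHom.ker (liftLocal φ hu) := by
    refine le_antisymm (span_le_ker_liftLocal φ hu hf hg) fun x hx => ?_
    obtain ⟨h, s, rfl⟩ := IsLocalization.exists_mk'_eq (pointIdeal a).primeCompl x
    have : φ h = 0 := by
      rw [← liftLocal_algebraMap φ hu, ← IsLocalization.mk'_spec (LocalRingAt a) h s, map_mul,
        (RingHom.mem_ker).mp hx, zero_mul]
    rw [IsLocalization.mk'_eq_mul_mk'_one]
    exact Ideal.mul_mem_right _ _ (hker h this)
  rw [affineIntersectionNumber]
  exact ((Ideal.quotientEquivAlgOfEq ℂ hJ).trans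
    (Ideal.quotientKerAlgEquivOfSurjective
      (liftLocal_surjective φ hu hs))).toLinearEquiv.length_eq

end Lift

/-- Nakayama's lemma for the powers of the maximal ideal of a point. -/
theorem map_pow_le_of_le {J : Ideal (MvPolynomial (Fin 2) ℂ)} {n : ℕ}
    (h : pointIdeal a ^ n ≤ J ⊔ pointIdeal a ^ (n + 1)) :
    (pointIdeal a ^ n).map (algebraMap _ (LocalRingAt a)) ≤
      J.map (algebraMap _ (LocalRingAt a)) := by
  refine Submodule.le_of_le_smul_of_le_jacobson_bot
    (I := (pointIdeal a).map (algebraMap _ (LocalRingAt a))) (IsNoetherian.noetherian _) ?_ ?_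
  · rw [IsLocalRing.jacobson_eq_maximalIdeal _ bot_ne_top, Localization.AtPrime.map_eq_maximalIdeal]
  · have := Ideal.map_mono (f := algebraMap _ (LocalRingAt a)) h
    rwa [Ideal.map_sup, pow_succ', Ideal.map_mul] at this

theorem affineIntersectionNumber_eq_zero (hf : f ∉ pointIdeal a) :
    affineIntersectionNumber f g a = 0 := by
  have hf' : IsUnit (algebraMap _ (LocalRingAt a) f) :=
    IsLocalization.map_units (LocalRingAt a) (⟨f, hf⟩ : (pointIdeal a).primeCompl)
  have : Ideal.span {algebraMap _ (LocalRingAt a) f, algebraMap _ (LocalRingAt a) g} = ⊤ :=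
    Ideal.eq_top_of_isUnit_mem _ (Ideal.subset_span (Set.mem_insert _ _)) hf'
  rw [affineIntersectionNumber, Module.length_eq_zero_iff, Ideal.Quotient.subsingleton_iff]
  exact this

theorem mem_span_of_mem_map {n : ℕ} (hh : h ∈ pointIdeal a ^ n)
    (hn : pointIdeal a ^ n ≤ Ideal.span {f, g} ⊔ pointIdeal a ^ (n + 1)) :
    algebraMap _ (LocalRingAt a) h ∈
      Ideal.span {algebraMap _ (LocalRingAt a) f, algebraMap _ (LocalRingAt a) g} := by
  have := map_pow_le_of_le hn (Ideal.mem_map_of_mem _ hh)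
  rwa [Ideal.map_span, Set.image_pair] at this

/-- Curves that meet transversally have intersection number one. -/
theorem affineIntersectionNumber_eq_one (hf : f ∈ pointIdeal a) (hg : g ∈ pointIdeal a)
    (hd : eval a (dirDeriv (Pi.single 0 1) f) * eval a (dirDeriv (Pi.single 1 1) g) -
      eval a (dirDeriv (Pi.single 1 1) f) * eval a (dirDeriv (Pi.single 0 1) g) ≠ 0) :
    affineIntersectionNumber f g a = 1 := by
  have hf₁ := linear_expansion hf
  have hg₁ := linear_expansion hg
  set f₀ := eval a (dirDeriv (Pi.single 0 1) f)
  set f₁ := eval a (dirDeriv (Pi.single 1 1) f)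
  set g₀ := eval a (dirDeriv (Pi.single 0 1) g)
  set g₁ := eval a (dirDeriv (Pi.single 1 1) g)
  -- Modulo the square of the ideal, `f` and `g` are linear forms with invertible coefficient
  -- matrix; Cramer's rule recovers both coordinates.
  have hle : pointIdeal a ^ 1 ≤ Ideal.span {f, g} ⊔ pointIdeal a ^ (1 + 1) := by
    set J := Ideal.span {f, g} ⊔ pointIdeal a ^ (1 + 1)
    have h2 : pointIdeal a ^ 2 ≤ J := le_sup_right
    have hfJ : f ∈ J := Ideal.mem_sup_left (Ideal.subset_span (by simp))
    have hgJ : g ∈ J := Ideal.mem_sup_left (Ideal.subset_span (by simp))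
    have e₁ := sub_mem hfJ (h2 hf₁)
    have e₂ := sub_mem hgJ (h2 hg₁)
    rw [sub_sub_cancel] at e₁ e₂
    have hu : C ((f₀ * g₁ - f₁ * g₀)⁻¹) * C (f₀ * g₁ - f₁ * g₀) =
        (1 : MvPolynomial (Fin 2) ℂ) := by
      rw [← C_mul, inv_mul_cancel₀ hd, C_1]
    rw [C_sub, C_mul, C_mul] at hu
    have h₀ : X 0 - C (a 0) ∈ J := by
      convert J.mul_mem_left (C ((f₀ * g₁ - f₁ * g₀)⁻¹))
        (sub_mem (J.mul_mem_left (C g₁) e₁) (J.mul_mem_left (C f₁) e₂)) using 1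
      linear_combination (C (a 0) - X 0) * hu
    have h₁ : X 1 - C (a 1) ∈ J := by
      convert J.mul_mem_left (C ((f₀ * g₁ - f₁ * g₀)⁻¹))
        (sub_mem (J.mul_mem_left (C f₀) e₂) (J.mul_mem_left (C g₀) e₁)) using 1
      linear_combination (C (a 1) - X 1) * hu
    intro h hh
    rw [pow_one] at hh
    obtain ⟨u, v, rfl⟩ := exists_eq_of_mem_pointIdeal hh
    exact add_mem (J.mul_mem_right _ h₀) (J.mul_mem_right _ h₁)
  rw [affineIntersectionNumber_eq_length (A := ℂ) (aeval a), Module.length_eq_one]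
  · intro s hs
    simpa [mem_pointIdeal, coe_aeval_eq_eval] using hs
  · exact fun c => ⟨C c, by simp⟩
  · simpa [mem_pointIdeal, coe_aeval_eq_eval] using hf
  · simpa [mem_pointIdeal, coe_aeval_eq_eval] using hg
  · intro h hh
    refine mem_span_of_mem_map (n := 1) ?_ hle
    simpa [mem_pointIdeal, coe_aeval_eq_eval] using hh

/-- A double point and a simple point whose tangent is not a tangent of the double point have
intersection number two. -/
theorem affineIntersectionNumber_eq_two {α β γ : ℂ} (hf : f ∈ pointIdeal a)
    (hg : g - (C α * (X 0 - C (a 0)) ^ 2 + C β * ((X 0 - C (a 0)) * (X 1 - C (a 1))) +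
      C γ * (X 1 - C (a 1)) ^ 2) ∈ pointIdeal a ^ 3)
    (hd : α * eval a (dirDeriv (Pi.single 1 1) f) ^ 2 -
      β * (eval a (dirDeriv (Pi.single 1 1) f) * eval a (dirDeriv (Pi.single 0 1) f)) +
      γ * eval a (dirDeriv (Pi.single 0 1) f) ^ 2 ≠ 0) :
    affineIntersectionNumber g f a = 2 := by
  have hf₁ := linear_expansion hf
  have hf₂ := eval_dirDeriv_eq hf
  set f₀ := eval a (dirDeriv (Pi.single 0 1) f)
  set f₁ := eval a (dirDeriv (Pi.single 1 1) f)
  set u : MvPolynomial (Fin 2) ℂ := X 0 - C (a 0)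
  set v : MvPolynomial (Fin 2) ℂ := X 1 - C (a 1)
  have hu' : u ∈ pointIdeal a := X_sub_C_mem_pointIdeal a 0
  have hv' : v ∈ pointIdeal a := X_sub_C_mem_pointIdeal a 1
  set d := α * f₁ ^ 2 - β * (f₁ * f₀) + γ * f₀ ^ 2 with hd'
  -- With `L = f₀ u + f₁ v` the linear part of `f`, the quadratic forms `u L`, `v L` and the
  -- quadratic part of `g` span all quadratic forms. Their determinant is `d`, the quadratic part of
  -- `g` at the tangent direction `(f₁, -f₀)`, and the multipliers passed to `hcomb` are cofactors.
  have hle : pointIdeal a ^ 2 ≤ Ideal.span {g, f} ⊔ pointIdeal a ^ (2 + 1) := by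
    set J := Ideal.span {g, f} ⊔ pointIdeal a ^ (2 + 1)
    have h3 : pointIdeal a ^ 3 ≤ J := le_sup_right
    have hfJ : f ∈ J := Ideal.mem_sup_left (Ideal.subset_span (by simp))
    have hgJ : g ∈ J := Ideal.mem_sup_left (Ideal.subset_span (by simp))
    have e₁ : u * (C f₀ * u + C f₁ * v) ∈ J := by
      convert sub_mem (J.mul_mem_left u hfJ)
        (h3 (by rw [pow_succ']; exact Ideal.mul_mem_mul hu' hf₁)) using 1
      ring
    have e₂ : v * (C f₀ * u + C f₁ * v) ∈ J := by
      convert sub_mem (J.mul_mem_left v hfJ)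
        (h3 (by rw [pow_succ']; exact Ideal.mul_mem_mul hv' hf₁)) using 1
      ring
    have e₃ := sub_mem hgJ (h3 hg)
    rw [sub_sub_cancel] at e₃
    have hdu : C d⁻¹ * C d = (1 : MvPolynomial (Fin 2) ℂ) := by
      rw [← C_mul, inv_mul_cancel₀ hd, C_1]
    have hcomb : ∀ p q r : ℂ, C d⁻¹ * (C p * (u * (C f₀ * u + C f₁ * v)) +
        C q * (v * (C f₀ * u + C f₁ * v)) +
        C r * (C α * u ^ 2 + C β * (u * v) + C γ * v ^ 2)) ∈ J := fun p q r =>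
      J.mul_mem_left _ (add_mem (add_mem (J.mul_mem_left _ e₁) (J.mul_mem_left _ e₂))
        (J.mul_mem_left _ e₃))
    have huu : u * u ∈ J := by
      convert hcomb (γ * f₀ - β * f₁) (-(γ * f₁)) (f₁ ^ 2) using 1
      simp only [hd', C_sub, C_neg, C_mul, C_add, C_pow] at hdu ⊢
      linear_combination (-(u * u)) * hdu
    have huv : u * v ∈ J := by
      convert hcomb (α * f₁) (γ * f₀) (-(f₀ * f₁)) using 1
      simp only [hd', C_sub, C_neg, C_mul, C_add, C_pow] at hdu ⊢
      linear_combination (-(u * v)) * hdu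
    have hvv : v * v ∈ J := by
      convert hcomb (-(α * f₀)) (α * f₁ - β * f₀) (f₀ ^ 2) using 1
      simp only [hd', C_sub, C_neg, C_mul, C_add, C_pow] at hdu ⊢
      linear_combination (-(v * v)) * hdu
    rw [pow_two, Ideal.mul_le]
    intro x hx y hy
    obtain ⟨x₀, x₁, rfl⟩ := exists_eq_of_mem_pointIdeal hx
    obtain ⟨y₀, y₁, rfl⟩ := exists_eq_of_mem_pointIdeal hy
    convert add_mem (add_mem (J.mul_mem_left (x₀ * y₀) huu)
      (J.mul_mem_left (x₀ * y₁ + x₁ * y₀) huv)) (J.mul_mem_left (x₁ * y₁) hvv) using 1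
    ring
  have hg₂ : g ∈ pointIdeal a ^ 2 := by
    refine (Submodule.sub_mem_iff_left _ ?_).mp (Ideal.pow_le_pow_right (by norm_num) hg)
    have hm : ∀ x ∈ pointIdeal a, ∀ y ∈ pointIdeal a, x * y ∈ pointIdeal a ^ 2 := fun x hx y hy =>
      pow_two (pointIdeal a) ▸ Ideal.mul_mem_mul hx hy
    rw [pow_two u, pow_two v]
    exact add_mem (add_mem (Ideal.mul_mem_left _ _ (hm u hu' u hu'))
      (Ideal.mul_mem_left _ _ (hm u hu' v hv'))) (Ideal.mul_mem_left _ _ (hm v hv' v hv'))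
  have hw : (![f₁, -f₀] : Fin 2 → ℂ) ≠ 0 := by
    intro h0
    have h₁ := congrFun h0 0
    have h₀ := congrFun h0 1
    simp at h₀ h₁
    exact hd (by rw [hd', h₀, h₁]; ring)
  rw [affineIntersectionNumber_eq_length (evalDual a ![f₁, -f₀]) (fun s => isUnit_evalDual)
    (evalDual_surjective a hw), length_dualNumber]
  · exact evalDual_eq_zero_iff.mpr
      ⟨Ideal.pow_le_self two_ne_zero hg₂, eval_dirDeriv_of_mem_sq hg₂ _⟩
  · refine evalDual_eq_zero_iff.mpr ⟨hf, ?_⟩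
    rw [hf₂]
    simp
    ring
  · intro h hh
    obtain ⟨hh, hhv⟩ := evalDual_eq_zero_iff.mp hh
    have hh₁ := linear_expansion hh
    rw [eval_dirDeriv_eq hh] at hhv
    set h₀ := eval a (dirDeriv (Pi.single 0 1) h)
    set h₁ := eval a (dirDeriv (Pi.single 1 1) h)
    simp only [Matrix.cons_val_zero, Matrix.cons_val_one] at hhv
    -- The linear part of `h` vanishes on the tangent direction of `f`, hence is a multiple of that
    -- of `f`; subtracting this multiple of `f` leaves an element of the squared ideal, which `hle`
    -- handles.
    obtain ⟨c, hc₀, hc₁⟩ : ∃ c, h₀ = c * f₀ ∧ h₁ = c * f₁ := by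
      by_cases hz : f₀ = 0
      · have hz₁ : f₁ ≠ 0 := fun hz₁ => hd (by rw [hd', hz, hz₁]; ring)
        refine ⟨h₁ / f₁, ?_, by field_simp⟩
        field_simp
        linear_combination hhv
      · refine ⟨h₀ / f₀, by field_simp, ?_⟩
        field_simp
        linear_combination -hhv
    have hmem : h - C c * f ∈ pointIdeal a ^ 2 := by
      convert sub_mem hh₁ (Ideal.mul_mem_left _ (C c) hf₁) using 1
      rw [hc₀, hc₁, C_mul, C_mul]
      ring
    have h1 := mem_span_of_mem_map hmem hle
    rw [map_sub, map_mul] at h1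
    exact (Submodule.sub_mem_iff_left _ (Ideal.mul_mem_left _ _
      (Ideal.subset_span (by simp)))).mp h1

/-- Both curves contain the infinitely near point in the direction `v`, so the quotient maps onto
the dual numbers. -/
theorem two_le_affineIntersectionNumber {v : Fin 2 → ℂ} (hv : v ≠ 0) (hf : f ∈ pointIdeal a)
    (hg : g ∈ pointIdeal a) (hfv : eval a (dirDeriv v f) = 0) (hgv : eval a (dirDeriv v g) = 0) :
    2 ≤ affineIntersectionNumber f g a := by
  rw [← length_dualNumber]
  exact length_le_affineIntersectionNumber (evalDual a v) (fun s => isUnit_evalDual)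
    (evalDual_surjective a hv) (evalDual_eq_zero_iff.mpr ⟨hf, hfv⟩)
    (evalDual_eq_zero_iff.mpr ⟨hg, hgv⟩)

end Local

/-! ### Forms in three variables: Taylor expansion along lines, divisibility, quartics. -/

section Homogeneous

variable {f : Form} {n : ℕ}

theorem dirDeriv_eq_sum (w : Fin 3 → ℂ) (f : Form) :
    dirDeriv w f = ∑ i, C (w i) * pderiv i f := by
  have : dirDeriv w = ∑ i, (C (w i) : Form) • pderiv i := by
    refine derivation_ext fun i => ?_
    fin_cases i <;> simp [Fin.sum_univ_three, pderiv_X]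
  simp [this, Fin.sum_univ_three]

theorem isHomogeneous_dirDeriv (hf : f.IsHomogeneous n) (w : Fin 3 → ℂ) :
    (dirDeriv w f).IsHomogeneous (n - 1) := by
  rw [dirDeriv_eq_sum]
  exact IsHomogeneous.sum _ _ _ fun i _ => hf.pderiv.C_mul _

theorem eval_dirDeriv_add (v w w' : Fin 3 → ℂ) (f : Form) :
    eval v (dirDeriv (w + w') f) = eval v (dirDeriv w f) + eval v (dirDeriv w' f) := by
  simp [dirDeriv_eq_sum, Fin.sum_univ_three]
  ring

theorem eval_dirDeriv_smul (v w : Fin 3 → ℂ) (c : ℂ) (f : Form) :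
    eval v (dirDeriv (c • w) f) = c * eval v (dirDeriv w f) := by
  simp [dirDeriv_eq_sum, Fin.sum_univ_three]
  ring

/-- Euler's identity. -/
theorem eval_dirDeriv_self (hf : f.IsHomogeneous n) (v : Fin 3 → ℂ) :
    eval v (dirDeriv v f) = n * eval v f := by
  have := congrArg (eval v) hf.sum_X_mul_pderiv
  simpa [dirDeriv_eq_sum] using this

/-- Euler's identity divided by the degree. It serves to prove the expansions along lines by
induction on the degree. -/
theorem exists_eq_sum_X_mul (hf : f.IsHomogeneous (n + 1)) :
    ∃ g : Fin 3 → Form, (∀ i, (g i).IsHomogeneous n) ∧ f = ∑ i, X i * g i := by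
  refine ⟨fun i => C ((n + 1 : ℂ)⁻¹) * pderiv i f, fun _ => hf.pderiv.C_mul _, ?_⟩
  have h := hf.sum_X_mul_pderiv
  have hn : (C ((n + 1 : ℂ)⁻¹) * C (n + 1 : ℂ) : Form) = 1 := by
    rw [← C_mul, inv_mul_cancel₀ (Nat.cast_add_one_ne_zero n), C_1]
  simp_rw [mul_left_comm (X _ : Form), ← Finset.mul_sum, h]
  rw [nsmul_eq_mul, ← mul_assoc]
  simp only [C_add, C_1, map_natCast, Nat.cast_add, Nat.cast_one] at hn ⊢
  rw [hn, one_mul]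

theorem eq_C_of_isHomogeneous_zero (hf : f.IsHomogeneous 0) : ∃ c, f = C c :=
  ⟨_, totalDegree_eq_zero_iff_eq_C.mp (Nat.le_zero.mp hf.totalDegree_le)⟩

theorem eval_smul_eq (hf : f.IsHomogeneous n) (c : ℂ) (v : Fin 3 → ℂ) :
    eval (c • v) f = c ^ n * eval v f := by
  induction n generalizing f with
  | zero =>
    obtain ⟨a, rfl⟩ := eq_C_of_isHomogeneous_zero hf
    simp
  | succ n ih =>
    obtain ⟨g, hg, rfl⟩ := exists_eq_sum_X_mul hf
    simp [ih (hg _), Fin.sum_univ_three]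
    ring

theorem eval_line_of_linear (hf : f.IsHomogeneous 1) (s t : ℂ) (p u : Fin 3 → ℂ) :
    eval (s • p + t • u) f = s * eval p f + t * eval u f := by
  obtain ⟨g, hg, rfl⟩ := exists_eq_sum_X_mul hf
  choose c hc using fun i => eq_C_of_isHomogeneous_zero (hg i)
  simp [hc, Fin.sum_univ_three]
  ring

theorem eval_dirDeriv_of_linear (hf : f.IsHomogeneous 1) (p u : Fin 3 → ℂ) :
    eval p (dirDeriv u f) = eval u f := by
  obtain ⟨g, hg, rfl⟩ := exists_eq_sum_X_mul hf
  choose c hc using fun i => eq_C_of_isHomogeneous_zero (hg i)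
  simp [hc, Fin.sum_univ_three]
  ring

theorem eval_line_of_quadratic (hf : f.IsHomogeneous 2) (s t : ℂ) (p u : Fin 3 → ℂ) :
    eval (s • p + t • u) f =
      s ^ 2 * eval p f + s * t * eval p (dirDeriv u f) + t ^ 2 * eval u f := by
  obtain ⟨g, hg, rfl⟩ := exists_eq_sum_X_mul hf
  simp [eval_line_of_linear (hg _), eval_dirDeriv_of_linear (hg _), Fin.sum_univ_three]
  ring

theorem eval_dirDeriv_comm_of_quadratic (hf : f.IsHomogeneous 2) (p u : Fin 3 → ℂ) :
    eval p (dirDeriv u f) = eval u (dirDeriv p f) := by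
  have h₁ := eval_line_of_quadratic hf 1 1 p u
  have h₂ := eval_line_of_quadratic hf 1 1 u p
  rw [add_comm] at h₂
  linear_combination h₂ - h₁

/-- By symmetry in the two points, the coefficient of `s * t ^ 2` is a first derivative at `u`, so
no second derivatives enter. -/
theorem eval_line_of_cubic (hf : f.IsHomogeneous 3) (s t : ℂ) (p u : Fin 3 → ℂ) :
    eval (s • p + t • u) f = s ^ 3 * eval p f + s ^ 2 * t * eval p (dirDeriv u f) +
      s * t ^ 2 * eval u (dirDeriv p f) + t ^ 3 * eval u f := by
  obtain ⟨g, hg, rfl⟩ := exists_eq_sum_X_mul hf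
  simp [eval_line_of_quadratic (hg _), eval_dirDeriv_comm_of_quadratic (hg _) p u,
    Fin.sum_univ_three]
  ring

theorem eq_zero_of_dvd {g : Form} {m : ℕ} (hf : f.IsHomogeneous n) (hg : g.IsHomogeneous m)
    (hf0 : f ≠ 0) (hmn : m < n) (h : f ∣ g) : g = 0 := by
  by_contra hg0
  have := totalDegree_le_of_dvd_of_isDomain h hg0
  rw [hf.totalDegree hf0, hg.totalDegree hg0] at this
  omega

theorem exists_eq_C_mul_of_dvd {g : Form} (hf : f.IsHomogeneous n) (hg : g.IsHomogeneous n)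
    (h : f ∣ g) : ∃ c, g = C c * f := by
  obtain ⟨r, rfl⟩ := h
  rcases eq_or_ne (f * r) 0 with h0 | h0
  · exact ⟨0, by simp [h0]⟩
  · have hd := totalDegree_mul_of_isDomain (left_ne_zero_of_mul h0) (right_ne_zero_of_mul h0)
    rw [hf.totalDegree (left_ne_zero_of_mul h0), hg.totalDegree h0] at hd
    have : r.totalDegree = 0 := by omega
    rw [totalDegree_eq_zero_iff_eq_C] at this
    exact ⟨coeff 0 r, by rw [mul_comm, ← this]⟩

theorem totalDegree_sub_top_lt (hf : 0 < f.totalDegree) :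
    (f - homogeneousComponent f.totalDegree f).totalDegree < f.totalDegree := by
  rw [totalDegree, Finset.sup_lt_iff hf]
  intro d hd
  rw [mem_support_iff, coeff_sub, coeff_homogeneousComponent] at hd
  split_ifs at hd with h
  · simp at hd
  · rw [sub_zero] at hd
    have := le_totalDegree (mem_support_iff.mpr hd)
    exact lt_of_le_of_ne this fun h' => h (by rw [← h']; rfl)

/-- The difference of the two products is homogeneous of degree `n` but has degree less than `n`.
Positive degrees matter: since `totalDegree 0 = 0`, removing the top component of a constant does
not lower its degree. -/
theorem homogeneousComponent_mul_of_isHomogeneous {A B : Form}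
    (h : (A * B).IsHomogeneous n) (hA : 0 < A.totalDegree) (hB : 0 < B.totalDegree) :
    A * B = homogeneousComponent A.totalDegree A * homogeneousComponent B.totalDegree B := by
  have hA0 : A ≠ 0 := fun h => by simp [h] at hA
  have hB0 : B ≠ 0 := fun h => by simp [h] at hB
  have hn : A.totalDegree + B.totalDegree = n := by
    rw [← totalDegree_mul_of_isDomain hA0 hB0, h.totalDegree (mul_ne_zero hA0 hB0)]
  set A' := homogeneousComponent A.totalDegree A
  set B' := homogeneousComponent B.totalDegree B
  have hA' : A'.IsHomogeneous A.totalDegree := homogeneousComponent_isHomogeneous _ _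
  have hB' : B'.IsHomogeneous B.totalDegree := homogeneousComponent_isHomogeneous _ _
  by_contra hne
  have hd : (A * B - A' * B').totalDegree = n :=
    (h.sub (hn ▸ hA'.mul hB')).totalDegree (sub_ne_zero.mpr hne)
  have e : A * B - A' * B' = (A - A') * B + A' * (B - B') := by ring
  have h₁ : ((A - A') * B).totalDegree < n := by
    have := totalDegree_mul (A - A') B
    have : (A - A').totalDegree < A.totalDegree := totalDegree_sub_top_lt hA
    omega
  have h₂ : (A' * (B - B')).totalDegree < n := by
    have := totalDegree_mul A' (B - B')
    have : (B - B').totalDegree < B.totalDegree := totalDegree_sub_top_lt hB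
    have := hA'.totalDegree_le
    omega
  rw [e] at hd
  have := totalDegree_add ((A - A') * B) (A' * (B - B'))
  omega

theorem finrank_homogeneousSubmodule_four_le :
    Module.finrank ℂ (homogeneousSubmodule (Fin 3) ℂ 4) ≤ 15 := by
  let s := (Finset.univ : Finset (Fin 3)).finsuppAntidiag 4
  let T : homogeneousSubmodule (Fin 3) ℂ 4 →ₗ[ℂ] (s → ℂ) :=
    LinearMap.pi fun d => lcoeff ℂ d.1 ∘ₗ Submodule.subtype _
  have hT : Function.Injective T := by
    rw [injective_iff_map_eq_zero]
    intro f hf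
    ext d
    by_cases hd : d.degree = 4
    · have hds : d ∈ s := by simpa [s, Finsupp.degree_eq_sum] using hd
      exact congrFun hf ⟨d, hds⟩
    · simpa using f.2.coeff_eq_zero hd
  have := LinearMap.finrank_le_finrank_of_injective hT
  rwa [Module.finrank_fintype_fun_eq_card, Fintype.card_coe,
    Finset.card_finsuppAntidiag_nat_eq_choose] at this

end Homogeneous

/-! ### Linear forms. -/

section LinearForms

/-- The linear form with given coefficients. -/
def linearForm : (Fin 3 → ℂ) →ₗ[ℂ] Form where
  toFun a := ∑ i, C (a i) * X i
  map_add' a b := by simp [add_mul, Finset.sum_add_distrib]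
  map_smul' c a := by simp [smul_eq_C_mul, Finset.mul_sum, mul_assoc]

theorem isHomogeneous_linearForm (a : Fin 3 → ℂ) : (linearForm a).IsHomogeneous 1 :=
  IsHomogeneous.sum _ _ _ fun _ _ => isHomogeneous_C_mul_X _ _

theorem eval_linearForm (a v : Fin 3 → ℂ) : eval v (linearForm a) = a ⬝ᵥ v := by
  simp [linearForm, dotProduct]

theorem linearForm_eq_zero {a : Fin 3 → ℂ} (h : linearForm a = 0) : a = 0 := by
  funext i
  simpa [eval_linearForm] using congrArg (eval (Pi.single i 1)) h

theorem eq_linearForm {f : Form} (hf : f.IsHomogeneous 1) : ∃ a, f = linearForm a := by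
  obtain ⟨g, hg, rfl⟩ := exists_eq_sum_X_mul hf
  choose c hc using fun i => eq_C_of_isHomogeneous_zero (hg i)
  exact ⟨c, by simp [linearForm, hc, mul_comm]⟩

theorem prime_linearForm {a : Fin 3 → ℂ} (ha : a ≠ 0) : Prime (linearForm a) := by
  have h0 : linearForm a ≠ 0 := fun h => ha (linearForm_eq_zero h)
  refine (irreducible_of_totalDegree_eq_one ((isHomogeneous_linearForm a).totalDegree h0)
    fun x hx => ?_).prime
  rw [isUnit_iff_ne_zero]
  rintro rfl
  exact h0 (by ext d; simpa using hx d)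

end LinearForms

/-! ### Lines and nonsingular cubics. -/

section Collinear

variable {p u : Fin 3 → ℂ} {E : Form}

theorem exists_of_cross_eq_zero {z : Fin 3 → ℂ} (h : LinearIndependent ℂ ![p, u])
    (hz : z ⬝ᵥ (crossProduct p u) = 0) : ∃ α β : ℂ, α • p + β • u = z := by
  by_contra hne
  rw [← Submodule.mem_span_pair] at hne
  have hi : LinearIndependent ℂ ![z, p, u] := by
    refine linearIndependent_finCons.mpr ⟨h, ?_⟩
    simpa [Matrix.range_cons, Set.pair_comm u p] using hne
  rw [triple_product_eq_det] at hz
  have : IsUnit (Matrix.of ![z, p, u]) := Matrix.linearIndependent_rows_iff_isUnit.mp hi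
  rw [Matrix.isUnit_iff_isUnit_det] at this
  exact this.ne_zero hz

/-- A nonsingular cubic contains no line: along such a line the tangential derivatives vanish, and
the derivative in a transversal direction is a binary quadratic form, whose zero would be a singular
point. -/
theorem not_forall_eval_line_eq_zero (hE : E.IsHomogeneous 3)
    (hns : ∀ v ≠ 0, ∃ w, eval v (dirDeriv w E) ≠ 0) (h : LinearIndependent ℂ ![p, u]) :
    ¬ ∀ s t : ℂ, eval (s • p + t • u) E = 0 := by
  intro hz
  have hp : eval p E = 0 := by simpa using hz 1 0
  have hu : eval u E = 0 := by simpa using hz 0 1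
  have hD : ∀ s t a b : ℂ, eval (s • p + t • u) (dirDeriv (a • p + b • u) E) = 0 := by
    intro s t a b
    have key : ∀ c : ℂ, eval ((1 : ℂ) • (s • p + t • u) + c • (a • p + b • u)) E = 0 := fun c => by
      rw [← hz (s + c * a) (t + c * b)]
      congr 2
      module
    have h₁ := key 1
    have h₂ := key (-1)
    -- The values at `c = 1` and `c = -1` differ by twice the first derivative.
    rw [eval_line_of_cubic hE, hz, hz] at h₁ h₂
    linear_combination (h₁ - h₂) / 2
  obtain ⟨w, hw⟩ := exists_linearIndependent_cons_of_lt_finrank h (by simp)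
  have hwE := isHomogeneous_dirDeriv hE w
  obtain ⟨s, t, hst, hq⟩ : ∃ s t : ℂ, ¬ (s = 0 ∧ t = 0) ∧
      eval (s • p + t • u) (dirDeriv w E) = 0 := by
    by_cases h0 : eval p (dirDeriv w E) = 0
    · exact ⟨1, 0, by simp, by simpa using h0⟩
    · obtain ⟨x, hx⟩ := exists_quadratic_eq_zero (b := eval p (dirDeriv u (dirDeriv w E)))
        (c := eval u (dirDeriv w E)) h0 (IsAlgClosed.exists_eq_mul_self _)
      refine ⟨x, 1, by simp, ?_⟩
      rw [eval_line_of_quadratic hwE]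
      linear_combination hx
  have hv : s • p + t • u ≠ 0 := fun h0 => hst (LinearIndependent.pair_iff.mp h s t h0)
  obtain ⟨x, hx⟩ := hns _ hv
  apply hx
  let B := basisOfLinearIndependentOfCardEqFinrank hw (by simp)
  have hB := B.sum_repr x
  rw [Fin.sum_univ_three] at hB
  simp only [B, coe_basisOfLinearIndependentOfCardEqFinrank, Fin.cons_zero] at hB
  rw [← hB, add_assoc, eval_dirDeriv_add, eval_dirDeriv_smul, hq, mul_zero, zero_add]
  exact hD s t _ _

/-- A proper factorization of a cubic has a factor of degree one. Its top component is a linear form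
that also divides `E`, so `E` would contain a line. -/
theorem irreducible_of_nonsingular (hE : E.IsHomogeneous 3)
    (hns : ∀ v ≠ 0, ∃ w, eval v (dirDeriv w E) ≠ 0) : Irreducible E := by
  have hlin : ∀ A B : Form, A.totalDegree = 1 → 0 < B.totalDegree → E ≠ A * B := by
    intro A B hA hB hAB
    rw [hAB] at hE hns
    have e := homogeneousComponent_mul_of_isHomogeneous hE (by omega) hB
    rw [e] at hE hns
    obtain ⟨a, ha⟩ := eq_linearForm (hA ▸ homogeneousComponent_isHomogeneous A.totalDegree A)
    rw [hA] at hE hns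
    rw [ha] at hE hns
    obtain ⟨p, u, hpu, hp, hu⟩ : ∃ p u, LinearIndependent ℂ ![p, u] ∧
        eval p (linearForm a) = 0 ∧ eval u (linearForm a) = 0 := by
      let T := Fintype.linearCombination ℂ a
      have h2 : 1 < Module.finrank ℂ (LinearMap.ker T) := by
        have h₁ := T.finrank_range_add_finrank_ker
        have h₂ := Submodule.finrank_le (LinearMap.range T)
        rw [Module.finrank_self] at h₂
        rw [Module.finrank_fin_fun] at h₁
        omega
      have : Nontrivial (LinearMap.ker T) := Module.nontrivial_of_finrank_pos (R := ℂ) (by omega)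
      obtain ⟨x, hx⟩ := exists_ne (0 : LinearMap.ker T)
      obtain ⟨y, hy⟩ := exists_linearIndependent_pair_of_one_lt_finrank h2 hx
      have hT : ∀ z : LinearMap.ker T, eval z.1 (linearForm a) = 0 := fun z => by
        rw [eval_linearForm, dotProduct_comm]
        have h : T z.1 = 0 := z.2
        rwa [Fintype.linearCombination_apply] at h
      refine ⟨x, y, ?_, hT x, hT y⟩
      have e : ![x.1, y.1] = Submodule.subtype _ ∘ ![x, y] := by
        ext i
        fin_cases i <;> rfl
      rw [e]
      exact hy.map' (Submodule.subtype _) (Submodule.ker_subtype _)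
    refine not_forall_eval_line_eq_zero hE hns hpu fun s t => ?_
    rw [map_mul, eval_line_of_linear (isHomogeneous_linearForm a), hp, hu]
    simp
  have hE0 : E ≠ 0 := by
    rintro rfl
    simpa using hns (Pi.single 0 1) (by simp)
  have hunit : ∀ A : Form, A ≠ 0 → A.totalDegree = 0 → IsUnit A := fun A hA h => by
    rw [totalDegree_eq_zero_iff_eq_C] at h
    rw [h] at hA ⊢
    exact (isUnit_iff_ne_zero.mpr fun h0 => hA (by simp [h0])).map C
  constructor
  · intro hu
    have := (isUnit_iff_totalDegree_of_isReduced.mp hu).2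
    rw [hE.totalDegree hE0] at this
    omega
  · intro A B hAB
    have hA0 : A ≠ 0 := by rintro rfl; simp [hAB] at hE0
    have hB0 : B ≠ 0 := by rintro rfl; simp [hAB] at hE0
    have hd := totalDegree_mul_of_isDomain hA0 hB0
    rw [← hAB, hE.totalDegree hE0] at hd
    by_contra! hAB'
    have hA : A.totalDegree ≠ 0 := fun h => hAB'.1 (hunit A hA0 h)
    have hB : B.totalDegree ≠ 0 := fun h => hAB'.2 (hunit B hB0 h)
    rcases (by omega : A.totalDegree = 1 ∨ B.totalDegree = 1) with h | h
    · exact hlin A B h (by omega) hAB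
    · exact hlin B A h (by omega) (hAB.trans (mul_comm _ _))

/-- The hypothesis `h0` says that the four points on the line are distinct, and a binary cubic form
with four zeros vanishes. -/
theorem not_four_collinear (hE : E.IsHomogeneous 3)
    (hns : ∀ v ≠ 0, ∃ w, eval v (dirDeriv w E) ≠ 0) (h : LinearIndependent ℂ ![p, u])
    (hp : eval p E = 0) (hu : eval u E = 0) {α β γ δ : ℂ}
    (hx : eval (α • p + β • u) E = 0) (hy : eval (γ • p + δ • u) E = 0)
    (h0 : α * β * γ * δ * (α * δ - β * γ) ≠ 0) : False := by
  refine not_forall_eval_line_eq_zero hE hns h fun s t => ?_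
  rw [eval_line_of_cubic hE, hp, hu] at *
  set A := eval p (dirDeriv u E)
  set B := eval u (dirDeriv p E)
  have hA : α * β * γ * δ * (α * δ - β * γ) * A = 0 := by
    linear_combination γ * δ ^ 2 * hx - α * β ^ 2 * hy
  have hB : α * β * γ * δ * (α * δ - β * γ) * B = 0 := by
    linear_combination α ^ 2 * β * hy - γ ^ 2 * δ * hx
  rw [(mul_eq_zero.mp hA).resolve_left h0, (mul_eq_zero.mp hB).resolve_left h0]
  ring

/-- On the tangent line the cubic has a double zero at `p`, and two further zeros are too many. -/
theorem not_two_collinear_tangent (hE : E.IsHomogeneous 3)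
    (hns : ∀ v ≠ 0, ∃ w, eval v (dirDeriv w E) ≠ 0) (h : LinearIndependent ℂ ![p, u])
    (hp : eval p E = 0) (hu : eval p (dirDeriv u E) = 0) {α β γ δ : ℂ}
    (hx : eval (α • p + β • u) E = 0) (hy : eval (γ • p + δ • u) E = 0)
    (h0 : β * δ * (α * δ - β * γ) ≠ 0) : False := by
  refine not_forall_eval_line_eq_zero hE hns h fun s t => ?_
  rw [eval_line_of_cubic hE, hp, hu] at *
  set A := eval u E
  set B := eval u (dirDeriv p E)
  have hA : (β * δ * (α * δ - β * γ)) ^ 2 * A = 0 := by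
    linear_combination (α * δ - β * γ) * (α * β ^ 2 * hy - γ * δ ^ 2 * hx)
  have hB : (β * δ * (α * δ - β * γ)) ^ 2 * B = 0 := by
    linear_combination (α * δ - β * γ) * (δ ^ 3 * hx - β ^ 3 * hy)
  rw [(mul_eq_zero.mp hA).resolve_left (pow_ne_zero 2 h0),
    (mul_eq_zero.mp hB).resolve_left (pow_ne_zero 2 h0)]
  ring

end Collinear

/-! ### Separating points by products of lines. -/

section Separation

variable {p : Fin 3 → ℂ}

theorem exists_linearForm_eval_ne_zero (hp : p ≠ 0) :
    ∃ ℓ : Form, ℓ.IsHomogeneous 1 ∧ eval p ℓ ≠ 0 := by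
  obtain ⟨i, hi⟩ := Function.ne_iff.mp hp
  exact ⟨X i, isHomogeneous_X _ _, by simpa using hi⟩

theorem exists_linearForm_separating {x : Fin 3 → ℂ} (h : LinearIndependent ℂ ![p, x]) :
    ∃ ℓ : Form, ℓ.IsHomogeneous 1 ∧ eval x ℓ = 0 ∧ eval p ℓ ≠ 0 := by
  obtain ⟨i, hi⟩ := Function.ne_iff.mp (crossProduct_ne_zero_iff_linearIndependent.mpr h)
  refine ⟨linearForm (crossProduct x (Pi.single i 1)), isHomogeneous_linearForm _, ?_, ?_⟩
  · rw [eval_linearForm, dotProduct_comm, dot_self_cross]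
  · rw [eval_linearForm, dotProduct_comm, ← triple_product_permutation]
    simpa using hi

theorem exists_line_through (x y : Fin 3 → ℂ) :
    ∃ ℓ : Form, ℓ.IsHomogeneous 1 ∧ eval x ℓ = 0 ∧ eval y ℓ = 0 ∧
      ∀ z, eval z ℓ = z ⬝ᵥ (crossProduct x y) := by
  have h : ∀ z, eval z (linearForm (crossProduct x y)) = z ⬝ᵥ (crossProduct x y) := fun z => by
    rw [eval_linearForm, dotProduct_comm]
  refine ⟨_, isHomogeneous_linearForm _, ?_, ?_, h⟩
  · rw [h, dot_self_cross]
  · rw [h, dot_cross_self]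

/-- If each line through `p` contains at most two of fewer than `2 k` points, then a product of
`k` linear forms separates these points from `p`. -/
theorem exists_form_separating {ι : Type*} [DecidableEq ι] (x : ι → Fin 3 → ℂ) (hp : p ≠ 0)
    (k : ℕ) : ∀ s : Finset ι, (∀ i ∈ s, LinearIndependent ℂ ![p, x i]) →
      (∀ i ∈ s, ∀ j ∈ s, ∀ l ∈ s, i ≠ j → i ≠ l → j ≠ l →
        p ⬝ᵥ (crossProduct (x i) (x j)) ≠ 0 ∨ p ⬝ᵥ (crossProduct (x i) (x l)) ≠ 0) →
      (s = ∅ ∨ s.card < 2 * k) →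
      ∃ f : Form, f.IsHomogeneous k ∧ (∀ i ∈ s, eval (x i) f = 0) ∧ eval p f ≠ 0 := by
  induction k with
  | zero =>
    intro s _ _ hs
    have hs : s = ∅ := hs.resolve_right (by simp)
    exact ⟨1, isHomogeneous_one _ _, by simp [hs], by simp⟩
  | succ k ih =>
    intro s hi h3 hs
    have step : ∀ t ⊆ s, (t = ∅ ∨ t.card < 2 * k) → ∀ ℓ : Form, ℓ.IsHomogeneous 1 →
        (∀ i ∈ s, i ∉ t → eval (x i) ℓ = 0) → eval p ℓ ≠ 0 →
        ∃ f : Form, f.IsHomogeneous (k + 1) ∧ (∀ i ∈ s, eval (x i) f = 0) ∧ eval p f ≠ 0 := by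
      intro t ht hcard ℓ hℓ hℓs hℓp
      obtain ⟨f, hf, hft, hfp⟩ := ih t (fun i h => hi i (ht h))
        (fun i h₁ j h₂ l h₃ => h3 i (ht h₁) j (ht h₂) l (ht h₃)) hcard
      refine ⟨f * ℓ, hf.mul hℓ, fun i his => ?_, by simp [hfp, hℓp]⟩
      by_cases hit : i ∈ t
      · simp [hft i hit]
      · simp [hℓs i his hit]
    -- Among three points, some two span a line missing `p`, and one linear form removes both. Once
    -- at most two points remain they may be collinear with `p` and are removed singly; the strict
    -- bound `s.card < 2 * k` leaves enough linear forms for this.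
    by_cases hc : 2 < s.card
    · obtain ⟨i, his, j, hjs, hij, hne⟩ : ∃ i ∈ s, ∃ j ∈ s, i ≠ j ∧
          p ⬝ᵥ (crossProduct (x i) (x j)) ≠ 0 := by
        obtain ⟨i, hi, j, hj, l, hl, hij, hil, hjl⟩ := Finset.two_lt_card.mp hc
        rcases h3 i hi j hj l hl hij hil hjl with h | h
        · exact ⟨i, hi, j, hj, hij, h⟩
        · exact ⟨i, hi, l, hl, hil, h⟩
      obtain ⟨ℓ, hℓ, hℓi, hℓj, hℓp⟩ := exists_line_through (x i) (x j)
      refine step ((s.erase i).erase j)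
        ((Finset.erase_subset _ _).trans (Finset.erase_subset _ _)) (Or.inr ?_) ℓ hℓ ?_
        (by rwa [hℓp])
      · have hs : s.card < 2 * (k + 1) := hs.resolve_left fun h => by simp [h] at hc
        rw [Finset.card_erase_of_mem (Finset.mem_erase.mpr ⟨hij.symm, hjs⟩),
          Finset.card_erase_of_mem his]
        omega
      · intro l hl hlt
        simp only [Finset.mem_erase, not_and] at hlt
        by_cases hlj : l = j
        · rwa [hlj]
        · by_cases hli : l = i
          · rwa [hli]
          · exact absurd hl (hlt hlj hli)
    · rcases s.eq_empty_or_nonempty with rfl | ⟨i, his⟩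
      · obtain ⟨ℓ, hℓ, hℓp⟩ := exists_linearForm_eval_ne_zero hp
        exact step ∅ subset_rfl (Or.inl rfl) ℓ hℓ (by simp) hℓp
      · obtain ⟨ℓ, hℓ, hℓi, hℓp⟩ := exists_linearForm_separating (hi i his)
        refine step (s.erase i) (Finset.erase_subset _ _) ?_ ℓ hℓ ?_ hℓp
        · have hs := hs.resolve_left (Finset.ne_empty_of_mem his)
          have := Finset.card_erase_of_mem his
          rw [← Finset.card_eq_zero]
          omega
        · intro l hl hlt
          rwa [show l = i by simpa [hl] using hlt]

end Separation

/-! ### Syzygies and the dimension count. -/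

section CayleyBacharach

variable {E G Q : Form}

theorem eq_smul_of_linearForm_mul_eq {n₁ n₂ m₁ m₂ : Fin 3 → ℂ}
    (hm : LinearIndependent ℂ ![m₁, m₂])
    (h : linearForm n₁ * linearForm m₂ = linearForm n₂ * linearForm m₁) :
    ∃ c : ℂ, n₁ = c • m₁ := by
  have h1 : m₁ ≠ 0 := hm.ne_zero 0
  have hC : ∀ a : Fin 3 → ℂ, linearForm m₁ ∣ linearForm a → ∃ c : ℂ, a = c • m₁ := fun a ha => by
    obtain ⟨c, hc⟩ := exists_eq_C_mul_of_dvd (isHomogeneous_linearForm _)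
      (isHomogeneous_linearForm _) ha
    refine ⟨c, sub_eq_zero.mp (linearForm_eq_zero ?_)⟩
    rw [map_sub, hc, map_smul, smul_eq_C_mul, sub_self]
  rcases (prime_linearForm h1).dvd_or_dvd (Dvd.intro_left _ h.symm) with h' | h'
  · exact hC _ h'
  · obtain ⟨c, hc⟩ := hC _ h'
    have := LinearIndependent.pair_iff.mp hm c (-1) (by rw [hc]; module)
    simp at this

/-- The prime `E` divides `B * G`; it does not divide `G`, so it divides `B`, whose degree is too
small unless `B = 0`. -/
theorem eq_zero_of_mul_add_mul_eq_zero (hE : E.IsHomogeneous 3) (hG : G.IsHomogeneous 3)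
    (hirr : Irreducible E) (hEG : ∀ c : ℂ, G ≠ C c * E) {A B : Form} {d : ℕ} (hd : d < 3)
    (hB : B.IsHomogeneous d) (h : A * E + B * G = 0) :
    A = 0 ∧ B = 0 := by
  have hB0 : B = 0 := by
    have hdvd : E ∣ B * G := ⟨-A, by linear_combination h⟩
    rcases hirr.prime.dvd_or_dvd hdvd with h' | h'
    · exact eq_zero_of_dvd hE hB hirr.ne_zero hd h'
    · obtain ⟨c, hc⟩ := exists_eq_C_mul_of_dvd hE hG h'
      exact absurd hc (hEG c)
  refine ⟨?_, hB0⟩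
  rw [hB0, zero_mul, add_zero] at h
  exact (mul_eq_zero.mp h).resolve_right hirr.ne_zero

/-- Two independent relations with linear coefficients between three cubics, one of them
irreducible, make the cubics linearly dependent. -/
theorem mem_span_of_two_relations (hE : E.IsHomogeneous 3) (hG : G.IsHomogeneous 3)
    (hirr : Irreducible E) (hEG : ∀ c : ℂ, G ≠ C c * E)
    {r₁ r₂ : (Fin 3 → ℂ) × (Fin 3 → ℂ) × (Fin 3 → ℂ)} (hr : LinearIndependent ℂ ![r₁, r₂])
    (h₁ : linearForm r₁.1 * E + linearForm r₁.2.1 * G + linearForm r₁.2.2 * Q = 0)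
    (h₂ : linearForm r₂.1 * E + linearForm r₂.2.1 * G + linearForm r₂.2.2 * Q = 0) :
    Q ∈ Submodule.span ℂ {E, G} := by
  obtain ⟨k₁, n₁, m₁⟩ := r₁
  obtain ⟨k₂, n₂, m₂⟩ := r₂
  dsimp only at h₁ h₂
  -- A dependence between the coefficients of `Q` would combine the relations into one between `E`
  -- and `G` alone, which is trivial.
  have hm : LinearIndependent ℂ ![m₁, m₂] := by
    rw [LinearIndependent.pair_iff] at hr ⊢
    intro s t hst
    have hst' := congrArg linearForm hst
    rw [map_zero, map_add, map_smul, map_smul, smul_eq_C_mul, smul_eq_C_mul] at hst'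
    obtain ⟨hk, hn⟩ := eq_zero_of_mul_add_mul_eq_zero (A := linearForm (s • k₁ + t • k₂))
      (B := linearForm (s • n₁ + t • n₂)) hE hG hirr hEG (d := 1) (by norm_num)
      (isHomogeneous_linearForm _) (by
        simp only [map_add, map_smul, smul_eq_C_mul]
        linear_combination C s * h₁ + C t * h₂ - Q * hst')
    refine hr s t ?_
    simp [linearForm_eq_zero hk, linearForm_eq_zero hn, hst]
  -- Eliminating `Q` leaves quadratic coefficients, which vanish because 2 < 3. Then `m₁` divides
  -- `k₁` and `n₁` and cancels from the first relation.
  obtain ⟨hk, hn⟩ := eq_zero_of_mul_add_mul_eq_zero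
    (A := linearForm k₁ * linearForm m₂ - linearForm k₂ * linearForm m₁)
    (B := linearForm n₁ * linearForm m₂ - linearForm n₂ * linearForm m₁)
    hE hG hirr hEG (d := 1 + 1) (by norm_num)
    (((isHomogeneous_linearForm _).mul (isHomogeneous_linearForm _)).sub
      ((isHomogeneous_linearForm _).mul (isHomogeneous_linearForm _)))
    (by linear_combination linearForm m₂ * h₁ - linearForm m₁ * h₂)
  obtain ⟨c, hc⟩ := eq_smul_of_linearForm_mul_eq hm (sub_eq_zero.mp hk)
  obtain ⟨d, hd⟩ := eq_smul_of_linearForm_mul_eq hm (sub_eq_zero.mp hn)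
  have hm0 : linearForm m₁ ≠ 0 := fun h => hm.ne_zero 0 (linearForm_eq_zero h)
  have : C c * E + C d * G + Q = 0 := by
    refine (mul_eq_zero.mp (?_ : linearForm m₁ * _ = 0)).resolve_left hm0
    rw [hc, hd, map_smul, map_smul, smul_eq_C_mul, smul_eq_C_mul] at h₁
    linear_combination h₁
  rw [Submodule.mem_span_pair]
  refine ⟨-c, -d, ?_⟩
  rw [smul_eq_C_mul, smul_eq_C_mul, C_neg, C_neg]
  linear_combination -this

/-- If seven points and a further linear condition are separated by quartics, then the cubics
satisfying these conditions on an irreducible cubic form a pencil. -/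
theorem mem_span_of_separated (hE : E.IsHomogeneous 3) (hG : G.IsHomogeneous 3)
    (hQ : Q.IsHomogeneous 3)
    (hirr : Irreducible E) (hEG : ∀ c : ℂ, G ≠ C c * E) (x : Fin 7 → Fin 3 → ℂ)
    (hx : ∀ i, eval (x i) E = 0 ∧ eval (x i) G = 0 ∧ eval (x i) Q = 0)
    (μ : Form →ₗ[ℂ] ℂ) (hμ : ∀ a, μ (linearForm a * E) = 0 ∧ μ (linearForm a * G) = 0 ∧
      μ (linearForm a * Q) = 0)
    (f : Fin 7 → Form) (hf : ∀ i, (f i).IsHomogeneous 4) (hfi : ∀ i, eval (x i) (f i) ≠ 0)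
    (hfj : ∀ i j, j ≠ i → eval (x j) (f i) = 0) (g : Form) (hg : g.IsHomogeneous 4)
    (hgi : ∀ i, eval (x i) g = 0) (hgμ : μ g ≠ 0) : Q ∈ Submodule.span ℂ {E, G} := by
  have hmul : ∀ {R : Form}, R.IsHomogeneous 3 → ∀ a : Fin 3 → ℂ,
      linearForm a * R ∈ homogeneousSubmodule (Fin 3) ℂ 4 := fun hR a =>
    (isHomogeneous_linearForm a).mul hR
  -- The source has dimension 9 + 7 + 1 = 17 and the target at most 15, so the kernel has dimension
  -- at least 2. Evaluating at the points and then applying `μ` shows that kernel elements do not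
  -- involve the `f i` or `g`: they are syzygies.
  let Φ : ((Fin 3 → ℂ) × (Fin 3 → ℂ) × (Fin 3 → ℂ)) × (Fin 7 → ℂ) × ℂ →ₗ[ℂ]
      homogeneousSubmodule (Fin 3) ℂ 4 :=
    { toFun := fun r => ⟨linearForm r.1.1 * E + linearForm r.1.2.1 * G + linearForm r.1.2.2 * Q +
          (∑ i, r.2.1 i • f i) + r.2.2 • g,
        add_mem (add_mem (add_mem (add_mem (hmul hE _) (hmul hG _)) (hmul hQ _))
          (Submodule.sum_mem _ fun i _ => Submodule.smul_mem _ _ (hf i)))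
          (Submodule.smul_mem _ _ hg)⟩
      map_add' := fun r r' => by
        ext1
        simp only [Prod.fst_add, Prod.snd_add, map_add, Pi.add_apply, add_smul,
          Finset.sum_add_distrib, Submodule.coe_add]
        ring
      map_smul' := fun c r => by
        ext1
        simp only [Prod.smul_fst, Prod.smul_snd, map_smul, Pi.smul_apply, smul_assoc,
          ← Finset.smul_sum, Submodule.coe_smul, smul_mul_assoc, smul_add, RingHom.id_apply] }
  have hker : ∀ r : LinearMap.ker Φ, r.1.2 = 0 ∧ linearForm r.1.1.1 * E +
      linearForm r.1.1.2.1 * G + linearForm r.1.1.2.2 * Q = 0 := by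
    rintro ⟨⟨⟨k, n, m⟩, c, e⟩, hr⟩
    have hr : linearForm k * E + linearForm n * G + linearForm m * Q +
        (∑ i, c i • f i) + e • g = 0 := congrArg Subtype.val (LinearMap.mem_ker.mp hr)
    have hc : c = 0 := by
      funext j
      have := congrArg (eval (x j)) hr
      simp only [map_add, map_mul, map_sum, smul_eval, hx, hgi, map_zero, mul_zero] at this
      rw [Finset.sum_eq_single j (fun i _ hij => by rw [hfj i j hij.symm, mul_zero])
        (by simp)] at this
      simpa [hfi] using this
    subst hc
    have he : e = 0 := by
      have := congrArg μ hr
      simpa [hμ, hgμ] using this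
    subst he
    exact ⟨rfl, by simpa using hr⟩
  have h2 : 1 < Module.finrank ℂ (LinearMap.ker Φ) := by
    have : Module.Finite ℂ (homogeneousSubmodule (Fin 3) ℂ 4) :=
      Module.Finite.iff_fg.mpr (homogeneousSubmodule_fg _ _ _)
    have h₁ := Φ.finrank_range_add_finrank_ker
    have h₂ := (Submodule.finrank_le (LinearMap.range Φ)).trans
      finrank_homogeneousSubmodule_four_le
    simp only [Module.finrank_prod, Module.finrank_fin_fun, Module.finrank_self] at h₁
    omega
  have : Nontrivial (LinearMap.ker Φ) := Module.nontrivial_of_finrank_pos (R := ℂ) (by omega)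
  obtain ⟨r₁, hr₁⟩ := exists_ne (0 : LinearMap.ker Φ)
  obtain ⟨r₂, hr⟩ := exists_linearIndependent_pair_of_one_lt_finrank h2 hr₁
  refine mem_span_of_two_relations hE hG hirr hEG (r₁ := r₁.1.1) (r₂ := r₂.1.1) ?_
    (hker r₁).2 (hker r₂).2
  rw [LinearIndependent.pair_iff] at hr ⊢
  intro s t hst
  refine hr s t (Subtype.ext (Prod.ext hst ?_))
  simp [(hker r₁).1, (hker r₂).1]

end CayleyBacharach

/-! ### Cayley-Bacharach on a nonsingular cubic. -/

section EightPoints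

variable {E : Form}

/-- A line through a point `p` of a nonsingular cubic contains at most two further points. -/
theorem cross_ne_zero_or (hE : E.IsHomogeneous 3)
    (hns : ∀ v ≠ 0, ∃ w, eval v (dirDeriv w E) ≠ 0) {p x y z : Fin 3 → ℂ}
    (hpx : LinearIndependent ℂ ![p, x])
    (hpy : LinearIndependent ℂ ![p, y]) (hpz : LinearIndependent ℂ ![p, z])
    (hxy : LinearIndependent ℂ ![x, y]) (hxz : LinearIndependent ℂ ![x, z])
    (hyz : LinearIndependent ℂ ![y, z]) (hp : eval p E = 0) (hx : eval x E = 0)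
    (hy : eval y E = 0) (hz : eval z E = 0) :
    p ⬝ᵥ (crossProduct x y) ≠ 0 ∨ p ⬝ᵥ (crossProduct x z) ≠ 0 := by
  by_contra! h
  obtain ⟨h₁, h₂⟩ := h
  rw [triple_product_permutation, triple_product_permutation] at h₁ h₂
  obtain ⟨α, β, rfl⟩ := exists_of_cross_eq_zero hpx h₁
  obtain ⟨γ, δ, rfl⟩ := exists_of_cross_eq_zero hpx h₂
  have hα : α ≠ 0 := by
    rintro rfl
    simpa using LinearIndependent.pair_iff.mp hxy (-β) 1 (by module)
  have hβ : β ≠ 0 := by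
    rintro rfl
    simpa using LinearIndependent.pair_iff.mp hpy (-α) 1 (by module)
  have hγ : γ ≠ 0 := by
    rintro rfl
    simpa using LinearIndependent.pair_iff.mp hxz (-δ) 1 (by module)
  have hδ : δ ≠ 0 := by
    rintro rfl
    simpa using LinearIndependent.pair_iff.mp hpz (-γ) 1 (by module)
  have hdet : α * δ - β * γ ≠ 0 := by
    intro h0
    have := LinearIndependent.pair_iff.mp hyz γ (-α) (by
      rw [show γ • (α • p + β • x) + -α • (γ • p + δ • x) = -(α * δ - β * γ) • x by module, h0]
      simp)
    exact hγ this.1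
  exact not_four_collinear hE hns hpx hp hx hy hz (by positivity)

/-- The tangent at a point `p` of a nonsingular cubic contains at most one further point. -/
theorem cross_ne_zero_or_of_tangent (hE : E.IsHomogeneous 3)
    (hns : ∀ v ≠ 0, ∃ w, eval v (dirDeriv w E) ≠ 0) {p v y z : Fin 3 → ℂ}
    (hpv : LinearIndependent ℂ ![p, v])
    (hpy : LinearIndependent ℂ ![p, y]) (hpz : LinearIndependent ℂ ![p, z])
    (hyz : LinearIndependent ℂ ![y, z]) (hp : eval p E = 0) (hv : eval p (dirDeriv v E) = 0)
    (hy : eval y E = 0) (hz : eval z E = 0) :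
    y ⬝ᵥ (crossProduct p v) ≠ 0 ∨ z ⬝ᵥ (crossProduct p v) ≠ 0 := by
  by_contra! h
  obtain ⟨h₁, h₂⟩ := h
  obtain ⟨α, β, rfl⟩ := exists_of_cross_eq_zero hpv h₁
  obtain ⟨γ, δ, rfl⟩ := exists_of_cross_eq_zero hpv h₂
  have hβ : β ≠ 0 := by
    rintro rfl
    simpa using LinearIndependent.pair_iff.mp hpy (-α) 1 (by module)
  have hδ : δ ≠ 0 := by
    rintro rfl
    simpa using LinearIndependent.pair_iff.mp hpz (-γ) 1 (by module)
  have hdet : α * δ - β * γ ≠ 0 := by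
    intro h0
    have := LinearIndependent.pair_iff.mp hyz δ (-β) (by
      rw [show δ • (α • p + β • v) + -β • (γ • p + δ • v) = (α * δ - β * γ) • p by module, h0]
      simp)
    exact hδ this.1
  exact not_two_collinear_tangent hE hns hpv hp hv hy hz (by positivity)

variable {G Q : Form}

/-- Let `E` be a nonsingular cubic and let seven points and a further linear condition `μ` be
given, separated from the points by a quartic. The cubics that satisfy these conditions
form a pencil. -/
theorem mem_span_of_seven_points (hE : E.IsHomogeneous 3)
    (hns : ∀ v ≠ 0, ∃ w, eval v (dirDeriv w E) ≠ 0) (hG : G.IsHomogeneous 3)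
    (hQ : Q.IsHomogeneous 3) (hEG : ∀ c : ℂ, G ≠ C c * E) {x : Fin 7 → Fin 3 → ℂ}
    (hind : ∀ i j, i ≠ j → LinearIndependent ℂ ![x i, x j])
    (hx : ∀ i, eval (x i) E = 0 ∧ eval (x i) G = 0 ∧ eval (x i) Q = 0)
    (μ : Form →ₗ[ℂ] ℂ) (hμ : ∀ a, μ (linearForm a * E) = 0 ∧ μ (linearForm a * G) = 0 ∧
      μ (linearForm a * Q) = 0) (g : Form) (hg : g.IsHomogeneous 4)
    (hgi : ∀ i, eval (x i) g = 0) (hgμ : μ g ≠ 0) : Q ∈ Submodule.span ℂ {E, G} := by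
  have hf : ∀ i, ∃ f : Form, f.IsHomogeneous 4 ∧
      (∀ j ∈ Finset.univ.erase i, eval (x j) f = 0) ∧ eval (x i) f ≠ 0 := by
    intro i
    refine exists_form_separating x ?_ 4 _ ?_ ?_ (Or.inr (by simp))
    · obtain ⟨j, hj⟩ := exists_ne i
      exact (hind i j hj.symm).ne_zero 0
    · intro j hj
      exact hind i j (by simpa [eq_comm] using hj)
    · intro j hj k hk l hl hjk hjl hkl
      simp only [Finset.mem_erase, Finset.mem_univ, and_true] at hj hk hl
      exact cross_ne_zero_or hE hns (hind _ _ hj.symm) (hind _ _ hk.symm) (hind _ _ hl.symm)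
        (hind _ _ hjk) (hind _ _ hjl) (hind _ _ hkl) (hx i).1 (hx j).1 (hx k).1 (hx l).1
  choose f hf hfj hfi using hf
  exact mem_span_of_separated hE hG hQ (irreducible_of_nonsingular hE hns) hEG x hx μ hμ f hf hfi
    (fun i j hj => hfj i j (by simpa using hj)) g hg hgi hgμ

/-- The Cayley-Bacharach theorem for eight distinct points on a nonsingular cubic. -/
theorem mem_span_of_eight_points (hE : E.IsHomogeneous 3)
    (hns : ∀ v ≠ 0, ∃ w, eval v (dirDeriv w E) ≠ 0) (hG : G.IsHomogeneous 3)
    (hQ : Q.IsHomogeneous 3) (hEG : ∀ c : ℂ, G ≠ C c * E) {x : Fin 7 → Fin 3 → ℂ}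
    (hind : ∀ i j, i ≠ j → LinearIndependent ℂ ![x i, x j])
    (hx : ∀ i, eval (x i) E = 0 ∧ eval (x i) G = 0 ∧ eval (x i) Q = 0) {q : Fin 3 → ℂ}
    (hqx : ∀ i, LinearIndependent ℂ ![q, x i])
    (hq : eval q E = 0 ∧ eval q G = 0 ∧ eval q Q = 0) : Q ∈ Submodule.span ℂ {E, G} := by
  obtain ⟨g, hg, hgx, hgq⟩ := exists_form_separating x ((hqx 0).ne_zero 0) 4 Finset.univ
    (fun i _ => hqx i) (fun i _ j _ k _ hij hik hjk => cross_ne_zero_or hE hns (hqx i) (hqx j)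
      (hqx k) (hind i j hij) (hind i k hik) (hind j k hjk) hq.1 (hx i).1 (hx j).1 (hx k).1)
    (Or.inr (by simp))
  refine mem_span_of_seven_points hE hns hG hQ hEG hind hx (aeval q).toLinearMap ?_ g hg
    (fun i => hgx i (Finset.mem_univ i)) ?_
  · intro a
    simp [hq]
  · simpa [coe_aeval_eq_eval] using hgq

/-- The Cayley-Bacharach theorem for seven distinct points on a nonsingular cubic and a tangent
direction at one of them. -/
theorem mem_span_of_seven_points_of_tangent (hE : E.IsHomogeneous 3)
    (hns : ∀ v ≠ 0, ∃ w, eval v (dirDeriv w E) ≠ 0) (hG : G.IsHomogeneous 3)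
    (hQ : Q.IsHomogeneous 3) (hEG : ∀ c : ℂ, G ≠ C c * E) {x : Fin 7 → Fin 3 → ℂ}
    (hind : ∀ i j, i ≠ j → LinearIndependent ℂ ![x i, x j])
    (hx : ∀ i, eval (x i) E = 0 ∧ eval (x i) G = 0 ∧ eval (x i) Q = 0) {i : Fin 7}
    {v : Fin 3 → ℂ} (hv : LinearIndependent ℂ ![x i, v])
    (hd : eval (x i) (dirDeriv v E) = 0 ∧ eval (x i) (dirDeriv v G) = 0 ∧
      eval (x i) (dirDeriv v Q) = 0) : Q ∈ Submodule.span ℂ {E, G} := by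
  obtain ⟨k, hki, hk⟩ : ∃ k, k ≠ i ∧ x k ⬝ᵥ (crossProduct (x i) v) ≠ 0 := by
    obtain ⟨j, hj, k, hk, hjk⟩ : ∃ j, j ≠ i ∧ ∃ k, k ≠ i ∧ j ≠ k := by
      have : ∀ i : Fin 7, ∃ j, j ≠ i ∧ ∃ k, k ≠ i ∧ j ≠ k := by decide
      exact this i
    rcases cross_ne_zero_or_of_tangent hE hns hv (hind i j hj.symm) (hind i k hk.symm)
      (hind j k hjk) (hx i).1 hd.1 (hx j).1 (hx k).1 with h | h
    · exact ⟨j, hj, h⟩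
    · exact ⟨k, hk, h⟩
  -- Since `x k` is off the tangent, `ℓ` is nonzero at `v`. With a cubic `f` through the other five
  -- points and not through `x i`, the quartic `f * ℓ` vanishes at all seven points, while its
  -- derivative along `v` at `x i` is `f (x i) * ℓ v ≠ 0`.
  obtain ⟨ℓ, hℓ, hℓi, hℓk, hℓv⟩ := exists_line_through (x i) (x k)
  have hℓv' : eval v ℓ ≠ 0 := by
    rw [hℓv, triple_product_permutation, triple_product_permutation, ← cross_anticomm,
      dotProduct_neg]
    exact neg_ne_zero.mpr hk
  obtain ⟨f, hf, hfx, hfi⟩ := exists_form_separating x (hv.ne_zero 0) 3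
    ((Finset.univ.erase i).erase k)
    (fun j hj => hind i j (by
      simp only [Finset.mem_erase, Finset.mem_univ, and_true] at hj; exact hj.2.symm))
    (by
      intro j hj k hk l hl hjk hjl hkl
      simp only [Finset.mem_erase, Finset.mem_univ, and_true] at hj hk hl
      exact cross_ne_zero_or hE hns (hind _ _ hj.2.symm) (hind _ _ hk.2.symm)
        (hind _ _ hl.2.symm) (hind _ _ hjk) (hind _ _ hjl) (hind _ _ hkl) (hx i).1 (hx j).1
        (hx k).1 (hx l).1)
    (Or.inr (by
      rw [Finset.card_erase_of_mem (by simp [hki]), Finset.card_erase_of_mem (by simp)]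
      simp))
  replace hfi : eval (x i) f ≠ 0 := hfi
  refine mem_span_of_seven_points hE hns hG hQ hEG hind hx
    ((aeval (x i)).toLinearMap ∘ₗ (dirDeriv v).toLinearMap) ?_ (f * ℓ) (hf.mul hℓ) ?_ ?_
  · intro a
    simp [hx, hd]
  · intro j
    by_cases hjk : j = k
    · simp [hjk, hℓk]
    · by_cases hji : j = i
      · simp [hji, hℓi]
      · simp [hfx j (by simp [hjk, hji])]
  · simp [hℓi, eval_dirDeriv_of_linear hℓ, hfi, hℓv']

end EightPoints

/-! ### Passage between affine charts and homogeneous coordinates. -/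

section Charts

variable {p : Plane} {f g Q : Form} {n : ℕ}

theorem rep_chart_ne_zero (p : Plane) : p.rep (chart p) ≠ 0 :=
  (Function.ne_iff.mp p.rep_nonzero).choose_spec

theorem insertNth_affineCoord (p : Plane) :
    (chart p).insertNth (α := fun _ => ℂ) 1 (affineCoord p) = (p.rep (chart p))⁻¹ • p.rep := by
  refine (Fin.insertNth_eq_iff).mpr ⟨?_, ?_⟩
  · simp [rep_chart_ne_zero]
  · funext j
    simp [affineCoord, Fin.removeNth, div_eq_inv_mul]

theorem eval_dehomogenize (i : Fin 3) (a : Fin 2 → ℂ) (f : Form) :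
    eval a (dehomogenize i f) = eval (i.insertNth (α := fun _ => ℂ) 1 a) f := by
  induction f using MvPolynomial.induction_on with
  | C c => simp [dehomogenize]
  | add f g hf hg => simp [hf, hg]
  | mul_X f j hf =>
    rw [map_mul, map_mul, hf, map_mul, eval_X]
    congr 1
    refine Fin.succAboveCases i ?_ (fun k => ?_) j <;> simp [dehomogenize]

theorem eval_dirDeriv_dehomogenize (i : Fin 3) (a w : Fin 2 → ℂ) (f : Form) :
    eval a (dirDeriv w (dehomogenize i f)) =
      eval (i.insertNth (α := fun _ => ℂ) 1 a)
        (dirDeriv (i.insertNth (α := fun _ => ℂ) 0 w) f) := by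
  induction f using MvPolynomial.induction_on with
  | C c => simp [dehomogenize]
  | add f g hf hg => simp [hf, hg]
  | mul_X f j hf =>
    have hX : eval a (dirDeriv w (dehomogenize i (X j))) =
        i.insertNth (α := fun _ => ℂ) 0 w j := by
      refine Fin.succAboveCases i ?_ (fun k => ?_) j <;> simp [dehomogenize]
    rw [map_mul, dirDeriv_mul, dirDeriv_mul, map_add, map_add, map_mul, map_mul, map_mul, map_mul,
      hf, hX, eval_dehomogenize, eval_dehomogenize, dirDeriv_X, eval_C]

theorem eval_localEquation (hf : f.IsHomogeneous n) (p : Plane) :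
    eval (affineCoord p) (localEquation f p) = (p.rep (chart p))⁻¹ ^ n * eval p.rep f := by
  rw [localEquation, eval_dehomogenize, insertNth_affineCoord, eval_smul_eq hf]

theorem localEquation_mem_pointIdeal_iff (hf : f.IsHomogeneous n) :
    localEquation f p ∈ pointIdeal (affineCoord p) ↔ LiesOn p f := by
  rw [mem_pointIdeal, eval_localEquation hf, LiesOn]
  simp [rep_chart_ne_zero]

/-- The direction in the cone over the plane that corresponds to a direction in the chart of
`p`. -/
def liftDirection (p : Plane) (w : Fin 2 → ℂ) : Fin 3 → ℂ :=
  (chart p).insertNth (α := fun _ => ℂ) 0 w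

theorem eval_dirDeriv_localEquation_eq_zero_iff (hf : f.IsHomogeneous n) (w : Fin 2 → ℂ) :
    eval (affineCoord p) (dirDeriv w (localEquation f p)) = 0 ↔
      eval p.rep (dirDeriv (liftDirection p w) f) = 0 := by
  rw [localEquation, eval_dirDeriv_dehomogenize, insertNth_affineCoord,
    eval_smul_eq (isHomogeneous_dirDeriv hf _), liftDirection]
  simp [rep_chart_ne_zero]

theorem linearIndependent_rep_liftDirection {w : Fin 2 → ℂ} (hw : w ≠ 0) :
    LinearIndependent ℂ ![p.rep, liftDirection p w] := by
  rw [LinearIndependent.pair_iff]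
  intro s t hst
  have hs : s = 0 := by
    have := congrFun hst (chart p)
    simpa [liftDirection, rep_chart_ne_zero] using this
  obtain ⟨j, hj⟩ := Function.ne_iff.mp hw
  have := congrFun hst ((chart p).succAbove j)
  refine ⟨hs, ?_⟩
  simpa [liftDirection, hs, show w j ≠ 0 from hj] using this

theorem linearIndependent_rep {p q : Plane} (h : p ≠ q) :
    LinearIndependent ℂ ![p.rep, q.rep] := by
  have e : ![p.rep, q.rep] = Projectivization.rep ∘ ![p, q] := by
    ext i
    fin_cases i <;> rfl
  rw [e, ← Projectivization.independent_iff]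
  exact (Projectivization.independent_pair_iff_ne p q).mpr h

/-- By Euler's identity, a point where all derivatives vanish lies on the curve, and its local
equation there lies in the squared ideal. -/
theorem exists_dirDeriv_ne_zero (hf : f.IsHomogeneous 3) (hns : IsNonsingularCurve f) :
    ∀ v ≠ 0, ∃ w, eval v (dirDeriv w f) ≠ 0 := by
  intro v hv
  by_contra! h
  let p : Plane := Projectivization.mk ℂ v hv
  obtain ⟨c, hc⟩ : ∃ c : ℂ, p.rep = c • v := by
    obtain ⟨c, hc⟩ := Projectivization.exists_smul_eq_mk_rep ℂ v hv
    exact ⟨c, hc.symm⟩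
  have hd : ∀ w, eval p.rep (dirDeriv w f) = 0 := fun w => by
    rw [hc, eval_smul_eq (isHomogeneous_dirDeriv hf w), h, mul_zero]
  have hp : LiesOn p f := by
    have := eval_dirDeriv_self hf p.rep
    rw [hd] at this
    simpa [LiesOn] using this.symm
  refine (hns p hp).2 (mem_sq_of_dirDeriv ((localEquation_mem_pointIdeal_iff hf).mpr hp)
    fun w => ?_)
  exact (eval_dirDeriv_localEquation_eq_zero_iff hf w).mpr (hd _)

end Charts

/-! ### Conditions on the parameter of the pencil. -/

section Generic

theorem eventually_cofinite_of_quadratic {A B D : ℂ} (h : ¬ (A = 0 ∧ B = 0 ∧ D = 0)) :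
    ∀ᶠ c in cofinite, A + B * c + D * c ^ 2 ≠ 0 := by
  let q : Polynomial ℂ := Polynomial.C A + Polynomial.C B * Polynomial.X +
    Polynomial.C D * Polynomial.X ^ 2
  have hq : q ≠ 0 := by
    intro h0
    refine h ⟨?_, ?_, ?_⟩
    · simpa [q, Polynomial.coeff_X, Polynomial.coeff_C] using congrArg (Polynomial.coeff · 0) h0
    · simpa [q, Polynomial.coeff_X, Polynomial.coeff_C] using congrArg (Polynomial.coeff · 1) h0
    · simpa [q, Polynomial.coeff_X, Polynomial.coeff_C] using congrArg (Polynomial.coeff · 2) h0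
  have : {c | q.IsRoot c}.Finite := Polynomial.finite_setOfPred_isRoot hq
  refine this.subset fun c hc => ?_
  simpa [q] using hc

/-- Linear forms on the plane with vanishing determinant have a common zero. -/
theorem exists_common_zero {a b c d : ℂ} (h : a * d - b * c = 0) :
    ∃ w : Fin 2 → ℂ, w ≠ 0 ∧ w 0 * a + w 1 * b = 0 ∧ w 0 * c + w 1 * d = 0 := by
  by_cases hab : a = 0 ∧ b = 0
  · by_cases hcd : c = 0 ∧ d = 0
    · exact ⟨![1, 0], fun h => by simpa using congrFun h 0, by simp [hab], by simp [hcd]⟩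
    · refine ⟨![d, -c], fun h => hcd ?_, by simp [hab], by simp; ring⟩
      have h₀ := congrFun h 0
      have h₁ := congrFun h 1
      simp at h₀ h₁
      exact ⟨h₁, h₀⟩
  · refine ⟨![b, -a], fun h => hab ?_, by simp; ring, by simp; linear_combination -h⟩
    have h₀ := congrFun h 0
    have h₁ := congrFun h 1
    simp at h₀ h₁
    exact ⟨h₁, h₀⟩

end Generic

/-! ### Base-points and the general member of the pencil. -/

section Pencil

variable (P : CubicPencil)

theorem CubicPencil.isHomogeneous_member (C : ℂ) : (P.member C).IsHomogeneous 3 :=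
  P.homogeneous_F.sub (P.homogeneous_G.C_mul C)

theorem CubicPencil.span_member (C : ℂ) :
    Submodule.span ℂ {P.member C, P.G} ≤ Submodule.span ℂ {P.F, P.G} := by
  rw [Submodule.span_le, Set.insert_subset_iff, Set.singleton_subset_iff]
  refine ⟨?_, Submodule.subset_span (by simp)⟩
  rw [CubicPencil.member, ← smul_eq_C_mul]
  exact Submodule.sub_mem _ (Submodule.subset_span (by simp))
    (Submodule.smul_mem _ _ (Submodule.subset_span (by simp)))

theorem CubicPencil.ne_C_mul_member (C c : ℂ) : P.G ≠ MvPolynomial.C c * P.member C := by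
  intro h
  have := LinearIndependent.pair_iff.mp P.linearIndependent c (-(1 + c * C)) (by
    rw [CubicPencil.member] at h
    rw [smul_eq_C_mul, smul_eq_C_mul, C_neg, C_add, C_1, C_mul]
    linear_combination -h)
  obtain ⟨h₁, h₂⟩ := this
  simp [h₁] at h₂

theorem CubicPencil.eval_member_of_mem_basePoints {p : Plane} (hp : p ∈ P.basePoints) (C : ℂ) :
    eval p.rep (P.member C) = 0 := by
  have h₁ : eval p.rep P.F = 0 := hp.1
  have h₂ : eval p.rep P.G = 0 := hp.2
  simp [CubicPencil.member, h₁, h₂]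

variable {P} {b : Fin 7 → Plane} {Q : Form}

/-- A cubic outside of a nonsingular pencil that passes through seven base-points contains no
further base-point. -/
theorem CubicPencil.not_liesOn_of_notMem_span (hP : P.IsNonsingular) (hb : Function.Injective b)
    (hbase : ∀ i, b i ∈ P.basePoints) (hQ : Q.IsHomogeneous 3) (hQb : ∀ i, LiesOn (b i) Q)
    (hPQ : Q ∉ Submodule.span ℂ {P.F, P.G}) {q : Plane} (hq : q ∈ P.basePoints)
    (hqb : ∀ i, q ≠ b i) : ¬ LiesOn q Q := by
  intro hqQ
  obtain ⟨C, hC⟩ := hP.exists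
  exact hPQ (P.span_member C (mem_span_of_eight_points (P.isHomogeneous_member C)
    (exists_dirDeriv_ne_zero (P.isHomogeneous_member C) hC) P.homogeneous_G hQ
    (P.ne_C_mul_member C) (fun i j hij => linearIndependent_rep (hb.ne hij))
    (fun i => ⟨P.eval_member_of_mem_basePoints (hbase i) C, (hbase i).2, hQb i⟩)
    (fun i => linearIndependent_rep (hqb i))
    ⟨P.eval_member_of_mem_basePoints hq C, hq.2, hqQ⟩))

/-- A cubic outside of a nonsingular pencil that passes through seven base-points has no common
tangent direction with the curves of the pencil at any of them. -/
theorem CubicPencil.false_of_common_tangent (hP : P.IsNonsingular) (hb : Function.Injective b)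
    (hbase : ∀ i, b i ∈ P.basePoints) (hQ : Q.IsHomogeneous 3) (hQb : ∀ i, LiesOn (b i) Q)
    (hPQ : Q ∉ Submodule.span ℂ {P.F, P.G}) (i : Fin 7) {w : Fin 2 → ℂ} (hw : w ≠ 0)
    (hF : eval (affineCoord (b i)) (dirDeriv w (localEquation P.F (b i))) = 0)
    (hG : eval (affineCoord (b i)) (dirDeriv w (localEquation P.G (b i))) = 0)
    (hQw : eval (affineCoord (b i)) (dirDeriv w (localEquation Q (b i))) = 0) : False := by
  rw [eval_dirDeriv_localEquation_eq_zero_iff P.homogeneous_F] at hF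
  rw [eval_dirDeriv_localEquation_eq_zero_iff P.homogeneous_G] at hG
  rw [eval_dirDeriv_localEquation_eq_zero_iff hQ] at hQw
  obtain ⟨C, hC⟩ := hP.exists
  exact hPQ (P.span_member C (mem_span_of_seven_points_of_tangent (P.isHomogeneous_member C)
    (exists_dirDeriv_ne_zero (P.isHomogeneous_member C) hC) P.homogeneous_G hQ
    (P.ne_C_mul_member C) (fun i j hij => linearIndependent_rep (hb.ne hij))
    (fun i => ⟨P.eval_member_of_mem_basePoints (hbase i) C, (hbase i).2, hQb i⟩)
    (linearIndependent_rep_liftDirection hw)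
    ⟨by simp [CubicPencil.member, hF, hG], hG, hQw⟩))

theorem CubicPencil.localEquation_member (C : ℂ) (p : Plane) :
    localEquation (P.member C) p =
      localEquation P.F p - MvPolynomial.C C * localEquation P.G p := by
  simp [localEquation, CubicPencil.member, dehomogenize]

/-- A curve that is singular at a base-point where `F = 0` and `G = 0` have intersection number
one does not belong to the pencil. -/
theorem CubicPencil.notMem_span_of_intersectionNumber_eq_one {p : Plane}
    (hp : p ∈ P.basePoints) (hI : intersectionNumber P.F P.G p = 1) (hQ0 : Q ≠ 0)
    (hQ : localEquation Q p ∈ pointIdeal (affineCoord p) ^ 2) :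
    Q ∉ Submodule.span ℂ {P.F, P.G} := by
  intro h
  obtain ⟨s, t, rfl⟩ := Submodule.mem_span_pair.mp h
  have hF := (localEquation_mem_pointIdeal_iff P.homogeneous_F).mpr hp.1
  have hG := (localEquation_mem_pointIdeal_iff P.homogeneous_G).mpr hp.2
  have hd : ∀ w, s * eval (affineCoord p) (dirDeriv w (localEquation P.F p)) +
      t * eval (affineCoord p) (dirDeriv w (localEquation P.G p)) = 0 := fun w => by
    simpa [localEquation, smul_eq_C_mul, dehomogenize] using eval_dirDeriv_of_mem_sq hQ w
  -- If the gradients of `F` and `G` were independent, singularity of `s F + t G` would force `s = t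
  -- = 0`.
  have hdet : eval (affineCoord p) (dirDeriv (Pi.single 0 1) (localEquation P.F p)) *
      eval (affineCoord p) (dirDeriv (Pi.single 1 1) (localEquation P.G p)) -
      eval (affineCoord p) (dirDeriv (Pi.single 1 1) (localEquation P.F p)) *
      eval (affineCoord p) (dirDeriv (Pi.single 0 1) (localEquation P.G p)) = 0 := by
    by_contra hne
    have h₀ := hd (Pi.single 0 1)
    have h₁ := hd (Pi.single 1 1)
    set f₀ := eval (affineCoord p) (dirDeriv (Pi.single 0 1) (localEquation P.F p))
    set f₁ := eval (affineCoord p) (dirDeriv (Pi.single 1 1) (localEquation P.F p))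
    set g₀ := eval (affineCoord p) (dirDeriv (Pi.single 0 1) (localEquation P.G p))
    set g₁ := eval (affineCoord p) (dirDeriv (Pi.single 1 1) (localEquation P.G p))
    have hs : s = 0 := (mul_eq_zero.mp (by linear_combination g₁ * h₀ - g₀ * h₁ :
      (f₀ * g₁ - f₁ * g₀) * s = 0)).resolve_left hne
    have ht : t = 0 := (mul_eq_zero.mp (by linear_combination f₀ * h₁ - f₁ * h₀ :
      (f₀ * g₁ - f₁ * g₀) * t = 0)).resolve_left hne
    exact hQ0 (by simp [hs, ht])
  obtain ⟨w, hw, hw₁, hw₂⟩ := exists_common_zero hdet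
  rw [← eval_dirDeriv_eq hF] at hw₁
  rw [← eval_dirDeriv_eq hG] at hw₂
  have := two_le_affineIntersectionNumber hw hF hG hw₁ hw₂
  rw [intersectionNumber] at hI
  rw [hI] at this
  exact absurd this (by norm_num)

/-- At a base-point without a common tangent direction, a simple point of `Q` is a transversal
intersection of `Q` with the general curve of the pencil. -/
theorem CubicPencil.eventually_intersectionNumber_eq_one {p : Plane} (hp : p ∈ P.basePoints)
    (hm : HasMultiplicity Q p 1)
    (hcommon : ∀ w : Fin 2 → ℂ, w ≠ 0 →
      eval (affineCoord p) (dirDeriv w (localEquation P.F p)) = 0 →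
      eval (affineCoord p) (dirDeriv w (localEquation P.G p)) = 0 →
      eval (affineCoord p) (dirDeriv w (localEquation Q p)) = 0 → False) :
    ∀ᶠ C in cofinite, intersectionNumber Q (P.member C) p = 1 := by
  have hF := (localEquation_mem_pointIdeal_iff P.homogeneous_F).mpr hp.1
  have hG := (localEquation_mem_pointIdeal_iff P.homogeneous_G).mpr hp.2
  obtain ⟨hQ₁, hQ₂⟩ := hm
  rw [pow_one] at hQ₁
  have hF' := eval_dirDeriv_eq hF
  have hG' := eval_dirDeriv_eq hG
  have hQ' := eval_dirDeriv_eq hQ₁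
  set a := affineCoord p
  set f := localEquation P.F p
  set g := localEquation P.G p
  set h := localEquation Q p
  set f₀ := eval a (dirDeriv (Pi.single 0 1) f) with hf₀
  set f₁ := eval a (dirDeriv (Pi.single 1 1) f) with hf₁
  set g₀ := eval a (dirDeriv (Pi.single 0 1) g) with hg₀
  set g₁ := eval a (dirDeriv (Pi.single 1 1) g) with hg₁
  set h₀ := eval a (dirDeriv (Pi.single 0 1) h)
  set h₁ := eval a (dirDeriv (Pi.single 1 1) h)
  -- The Jacobian of `Q` and `F - C G` is affine in `C`, hence the quadratic coefficient 0. If it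
  -- vanished identically, the tangent direction `(h₁, -h₀)` of `Q` would be common to `F` and `G`.
  have hne : ¬ (h₀ * f₁ - h₁ * f₀ = 0 ∧ -(h₀ * g₁ - h₁ * g₀) = 0 ∧ (0 : ℂ) = 0) := by
    rintro ⟨e₁, e₂, -⟩
    refine hcommon ![h₁, -h₀] (fun h0 => hQ₂ (mem_sq_of_dirDeriv hQ₁ fun w => ?_)) ?_ ?_ ?_
    · have z₀ := congrFun h0 0
      have z₁ := congrFun h0 1
      simp at z₀ z₁
      rw [hQ', z₀, z₁]
      ring
    · rw [hF']
      simp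
      linear_combination -e₁
    · rw [hG']
      simp
      linear_combination e₂
    · rw [hQ']
      simp
      ring
  filter_upwards [eventually_cofinite_of_quadratic hne] with C hC
  rw [intersectionNumber, CubicPencil.localEquation_member]
  refine affineIntersectionNumber_eq_one hQ₁ (sub_mem hF (Ideal.mul_mem_left _ _ hG)) ?_
  convert hC using 1
  simp
  ring

/-- At a base-point without a common tangent direction, a double point of `Q` has intersection
number two with the general curve of the pencil. -/
theorem CubicPencil.eventually_intersectionNumber_eq_two {p : Plane} (hp : p ∈ P.basePoints)
    (hm : HasMultiplicity Q p 2)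
    (hcommon : ∀ w : Fin 2 → ℂ, w ≠ 0 →
      eval (affineCoord p) (dirDeriv w (localEquation P.F p)) = 0 →
      eval (affineCoord p) (dirDeriv w (localEquation P.G p)) = 0 →
      eval (affineCoord p) (dirDeriv w (localEquation Q p)) = 0 → False) :
    ∀ᶠ C in cofinite, intersectionNumber Q (P.member C) p = 2 := by
  have hF := (localEquation_mem_pointIdeal_iff P.homogeneous_F).mpr hp.1
  have hG := (localEquation_mem_pointIdeal_iff P.homogeneous_G).mpr hp.2
  obtain ⟨hQ₁, hQ₂⟩ := hm
  have hF' := eval_dirDeriv_eq hF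
  have hG' := eval_dirDeriv_eq hG
  set a := affineCoord p
  set f := localEquation P.F p
  set g := localEquation P.G p
  set h := localEquation Q p
  set f₀ := eval a (dirDeriv (Pi.single 0 1) f) with hf₀
  set f₁ := eval a (dirDeriv (Pi.single 1 1) f) with hf₁
  set g₀ := eval a (dirDeriv (Pi.single 0 1) g) with hg₀
  set g₁ := eval a (dirDeriv (Pi.single 1 1) g) with hg₁
  -- All first derivatives of `Q` vanish at its double point, so any common tangent direction of `F`
  -- and `G` contradicts `hcommon`.
  have hdet : f₀ * g₁ - f₁ * g₀ ≠ 0 := by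
    intro h0
    obtain ⟨w, hw, hw₁, hw₂⟩ := exists_common_zero h0
    exact hcommon w hw ((hF' w).trans hw₁) ((hG' w).trans hw₂) (eval_dirDeriv_of_mem_sq hQ₁ w)
  obtain ⟨α, β, γ, hq⟩ := exists_quadratic_expansion hQ₁
  -- These are the coefficients in `C` of the quadratic part of `Q` at the tangent direction of `F -
  -- C G`: its values at the tangent directions of `F` and of `G`, and the polar term. Those
  -- directions form a basis, so if all three vanish then so does the quadratic part.
  have hne : ¬ (α * f₁ ^ 2 - β * (f₁ * f₀) + γ * f₀ ^ 2 = 0 ∧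
      -(2 * α * f₁ * g₁ - β * (f₁ * g₀ + f₀ * g₁) + 2 * γ * f₀ * g₀) = 0 ∧
      α * g₁ ^ 2 - β * (g₁ * g₀) + γ * g₀ ^ 2 = 0) := by
    rintro ⟨e₁, e₂, e₃⟩
    have hd := pow_ne_zero 2 hdet
    have hα : α = 0 := (mul_eq_zero.mp (by
      linear_combination g₀ ^ 2 * e₁ + f₀ * g₀ * e₂ + f₀ ^ 2 * e₃ :
        (f₀ * g₁ - f₁ * g₀) ^ 2 * α = 0)).resolve_left hd
    have hγ : γ = 0 := (mul_eq_zero.mp (by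
      linear_combination g₁ ^ 2 * e₁ + f₁ * g₁ * e₂ + f₁ ^ 2 * e₃ :
        (f₀ * g₁ - f₁ * g₀) ^ 2 * γ = 0)).resolve_left hd
    have hβ : β = 0 := (mul_eq_zero.mp (by
      linear_combination 2 * g₀ * g₁ * e₁ + (f₀ * g₁ + f₁ * g₀) * e₂ + 2 * f₀ * f₁ * e₃ :
        (f₀ * g₁ - f₁ * g₀) ^ 2 * β = 0)).resolve_left hd
    exact hQ₂ (by simpa [hα, hβ, hγ] using hq)
  filter_upwards [eventually_cofinite_of_quadratic hne] with C hC
  rw [intersectionNumber, CubicPencil.localEquation_member]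
  refine affineIntersectionNumber_eq_two (sub_mem hF (Ideal.mul_mem_left _ _ hG)) hq ?_
  convert hC using 1
  simp
  ring

end Pencil

end CubicPencils

end

/-! ### The proposition. -/

theorem proposition3
    (P : CubicPencils.CubicPencil) (hP : P.IsNonsingular)
    (b : Fin 7 → CubicPencils.Plane) (hb : Function.Injective b)
    (hbase : ∀ i, P.IsSimpleBasePoint (b i))
    (Q : CubicPencils.Form) (hQ : Q.IsHomogeneous 3)
    (hQ0 : CubicPencils.HasMultiplicity Q (b 0) 2)
    (hQi : ∀ i, i ≠ 0 → CubicPencils.HasMultiplicity Q (b i) 1)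
    (hPQ : CubicPencils.intersectionNumber P.F P.G (b 0) = 1 ∨
      Q ∉ Submodule.span ℂ {P.F, P.G}) :
    P.IsInvolutionCurve 3 Q ∧
      ∀ᶠ C in Filter.cofinite,
        CubicPencils.intersectionNumber Q (P.member C) (b 0) = 2 ∧
          ∀ i, i ≠ 0 → CubicPencils.intersectionNumber Q (P.member C) (b i) = 1 := by
  have hQne : Q ≠ 0 := by
    rintro rfl
    exact hQ0.2 (by simp [CubicPencils.localEquation])
  have hbase' : ∀ i, b i ∈ P.basePoints := fun i => (hbase i).1
  have hspan : Q ∉ Submodule.span ℂ {P.F, P.G} := hPQ.elim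
    (fun h => P.notMem_span_of_intersectionNumber_eq_one (hbase' 0) h hQne hQ0.1) id
  have hQb : ∀ i, CubicPencils.LiesOn (b i) Q := fun i => by
    rw [← CubicPencils.localEquation_mem_pointIdeal_iff hQ]
    rcases eq_or_ne i 0 with rfl | hi
    · exact Ideal.pow_le_self two_ne_zero hQ0.1
    · simpa using (hQi i hi).1
  have hcommon := fun i w hw =>
    CubicPencils.CubicPencil.false_of_common_tangent hP hb hbase' hQ hQb hspan i (w := w) hw
  have hI : ∀ᶠ C in Filter.cofinite,
      CubicPencils.intersectionNumber Q (P.member C) (b 0) = 2 ∧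
        ∀ i, i ≠ 0 → CubicPencils.intersectionNumber Q (P.member C) (b i) = 1 := by
    refine (CubicPencils.CubicPencil.eventually_intersectionNumber_eq_two (hbase' 0) hQ0
      (hcommon 0)).and (Filter.eventually_all.mpr fun i => ?_)
    by_cases hi : i = 0
    · simp [hi]
    · filter_upwards [CubicPencils.CubicPencil.eventually_intersectionNumber_eq_one (hbase' i)
        (hQi i hi) (hcommon i)] with C hC _ using hC
  refine ⟨⟨hQ, hQne, ?_⟩, hI⟩
  filter_upwards [hI] with C hC
  classical
  -- The set of base-points need not be known to be finite: `Q` misses all of them except the `b i`,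
  -- so the support of the sum lies in the range of `b`.
  have hsum : ∑ᶠ p ∈ P.basePoints, CubicPencils.intersectionNumber Q (P.member C) p =
      ∑ p ∈ Finset.univ.image b, CubicPencils.intersectionNumber Q (P.member C) p := by
    refine finsum_mem_eq_sum_of_inter_support_eq _ ?_
    ext p
    simp only [Set.mem_inter_iff, Finset.coe_image, Finset.coe_univ, Set.image_univ,
      Set.mem_range]
    refine ⟨fun ⟨hp, hs⟩ => ⟨?_, hs⟩, fun ⟨⟨i, hi⟩, hs⟩ => ⟨hi ▸ hbase' i, hs⟩⟩
    by_contra! hpb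
    refine hs (CubicPencils.affineIntersectionNumber_eq_zero ?_)
    rw [CubicPencils.localEquation_mem_pointIdeal_iff hQ]
    exact CubicPencils.CubicPencil.not_liesOn_of_notMem_span hP hb hbase' hQ hQb hspan hp
      fun i => (hpb i).symm
  rw [hsum, Finset.sum_image fun i _ j _ h => hb h, Fin.sum_univ_succ, hC.1,
    Finset.sum_congr rfl fun i _ => hC.2 _ (Fin.succ_ne_zero i)]
  norm_num
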